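/- Let $\mathfrak k$ be a finite-dimensional simple real Lie algebra with an invariant metric $\langle\cdot,\cdot\rangle$, i.e. an inner product for which every $\mathrm{ad}_Z$ is skew-symmetric (so $\mathfrak k$ is a compact simple Lie algebra). Let $G$ be a complex Lie group whose Lie algebra is the complexification $\mathfrak g=\mathfrak k\otimes_{\mathbb R}\mathbb C$; for instance, $G$ is the complexification of a compact simple Lie group with Lie algebra $\mathfrak k$. Let $\kappa^{-1}$ be the Hermitian metric on $\mathfrak g$ that extends $\langle\cdot,\cdot\rangle$ sesquilinearly, $\kappa^{-1}(a\otimes X,b\otimes Y)=a\bar b\,\langle X,Y\rangle$. Let $M=G/H$ be a complex homogeneous manifold of $G$: $G$ acts on the complex manifold $M$ holomorphically and transitively, and the orbit maps $G\to M$ are submersions. For $x\in M$ let $\mathrm{ev}_x\colon\mathfrak g\to T_xM$ be the surjective evaluation map, the differential at $1$ of $a\mapsto a\cdot x$, and let $g_0=\mathrm{ev}_*(\kappa^{-1})$ be the metric on $M$ obtained by restricting $\kappa^{-1}$ to $(\ker \mathrm{ev}_x)^{\perp}$ and transporting it to $T_xM$ by $\mathrm{ev}_x$. For a Hermitian metric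 $g$ with Chern connection $\nabla$, torsion $T$ and Chern curvature $\Omega$, let $$\Theta(g)_{i\bar j}=g^{m\bar n}\Omega_{m\bar n i\bar j}+\tfrac12\, g^{m\bar n}g^{p\bar s}T_{pm\bar j}T_{\bar s\bar n i}$$ be the torsion-twisted Chern-Ricci form; the Hermitian curvature flow is $\partial_t g=-\Theta(g)$. Then: 1. Minus the Killing form of $\mathfrak k$ is an invariant metric on $\mathfrak k$ (so that it is a possible choice of $\langle\cdot,\cdot\rangle$). 2. $g_0$ is a smooth Hermitian metric on $M$. 3. $g_0$ is scale-static under the Hermitian curvature flow: there is a constant $\lambda>0$ with $\Theta(g_0)=\lambda g_0$ on $M$. -/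

import Mathlib

open scoped Manifold ContDiff TensorProduct ComplexConjugate

noncomputable section

namespace HCF

/-- Complex `n`-space, the model of complex manifolds of dimension `n`. -/
abbrev Cn (n : ℕ) : Type := EuclideanSpace ℂ (Fin n)

/-! ### Chern connection and torsion-twisted Chern-Ricci form in holomorphic coordinates -/

section Local

variable {n : ℕ}

/-- The `i`-th standard basis vector. -/
def stdVec (i : Fin n) : Cn n := EuclideanSpace.single i 1

/-- The Wirtinger derivative `∂f/∂zᵢ = (∂f/∂xᵢ - √-1 ∂f/∂yᵢ)/2`. -/
def dz (i : Fin n) (f : Cn n → ℂ) (z : Cn n) : ℂ :=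
  (fderiv ℝ f z (stdVec i) - Complex.I * fderiv ℝ f z (Complex.I • stdVec i)) / 2

/-- The Wirtinger derivative `∂f/∂z̄ᵢ = (∂f/∂xᵢ + √-1 ∂f/∂yᵢ)/2`. -/
def dzBar (i : Fin n) (f : Cn n → ℂ) (z : Cn n) : ℂ :=
  (fderiv ℝ f z (stdVec i) + Complex.I * fderiv ℝ f z (Complex.I • stdVec i)) / 2

/-- A Hermitian metric in coordinates: the entry `(i, j)` of `g z` is `g_{i j̄}(z)`. -/
abbrev LocalMetric (n : ℕ) : Type := Cn n → Matrix (Fin n) (Fin n) ℂ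

/-- A vector field `∑ Yᵏ ∂/∂zₖ` of type `(1,0)` in coordinates. -/
abbrev LocalField (n : ℕ) : Type := Cn n → Fin n → ℂ

/-- The coordinate field `∂/∂zᵢ`. -/
def coordField (i : Fin n) : LocalField n := fun _ => Pi.single i 1

/-- The inverse metric `g^{i j̄}`, normalized by `∑ⱼ g^{i j̄} g_{k j̄} = δᵢₖ`. -/
def upper (g : LocalMetric n) (i j : Fin n) (z : Cn n) : ℂ := (g z)⁻¹ j i

/-- The Christoffel symbols `Γᵏᵢⱼ = ∑ₗ g^{k l̄} ∂ᵢ g_{j l̄}` of the Chern connection. -/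
def christoffel (g : LocalMetric n) (k i j : Fin n) (z : Cn n) : ℂ :=
  ∑ l, upper g k l z * dz i (fun w => g w j l) z

/-- The Christoffel symbols are determined by `∂ᵢ g_{j l̄} = g(∇ᵢ ∂ⱼ, ∂̄ₗ)`, that is by `∇g = 0`
and `∇^{0,1} = ∂̄`. -/
theorem sum_christoffel_mul (g : LocalMetric n) (i j l : Fin n) (z : Cn n)
    (h : IsUnit (g z).det) :
    ∑ k, christoffel g k i j z * g z k l = dz i (fun w => g w j l) z := by
  have h1 : ∀ m : Fin n, ∑ k, (g z)⁻¹ m k * g z k l = if m = l then 1 else 0 := by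
    intro m
    rw [← Matrix.mul_apply, Matrix.nonsing_inv_mul _ h, Matrix.one_apply]
  simp only [christoffel, upper, Finset.sum_mul]
  rw [Finset.sum_comm]
  calc _ = ∑ m, dz i (fun w => g w j m) z * ∑ k, (g z)⁻¹ m k * g z k l := by
        refine Finset.sum_congr rfl fun m _ => ?_
        rw [Finset.mul_sum]
        exact Finset.sum_congr rfl fun k _ => by ring
    _ = _ := by simp [h1]

/-- The covariant derivative `∇_{∂/∂zᵢ} Y` for the Chern connection. -/
def nabla (g : LocalMetric n) (i : Fin n) (Y : LocalField n) : LocalField n :=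
  fun z k => dz i (fun w => Y w k) z + ∑ j, christoffel g k i j z * Y z j

/-- The covariant derivative `∇_{∂/∂z̄ᵢ} Y` for the Chern connection, as `∇^{0,1} = ∂̄`. -/
def nablaBar (i : Fin n) (Y : LocalField n) : LocalField n :=
  fun z k => dzBar i (fun w => Y w k) z

/-- The torsion `T_{i j l̄} = g(∇ᵢ ∂ⱼ - ∇ⱼ ∂ᵢ - [∂ᵢ, ∂ⱼ], ∂̄ₗ)`; the bracket of coordinate
fields vanishes. -/
def torsion (g : LocalMetric n) (i j l : Fin n) (z : Cn n) : ℂ :=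
  ∑ p, (nabla g i (coordField j) z p - nabla g j (coordField i) z p) * g z p l

/-- The Chern curvature `Ω_{i j̄ k l̄} = g((∇ᵢ ∇_{j̄} - ∇_{j̄} ∇ᵢ - ∇_{[∂ᵢ, ∂̄ⱼ]}) ∂ₖ, ∂̄ₗ)`; the bracket
of coordinate fields vanishes. -/
def curvature (g : LocalMetric n) (i j k l : Fin n) (z : Cn n) : ℂ :=
  ∑ p, (nabla g i (nablaBar j (coordField k)) z p
    - nablaBar j (nabla g i (coordField k)) z p) * g z p l

/-- The torsion-twisted Chern-Ricci form
`Θ_{i j̄} = g^{m n̄} Ω_{m n̄ i j̄} + (1/2) g^{m n̄} g^{p s̄} T_{p m j̄} T_{s̄ n̄ i}`, where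
`T_{s̄ n̄ i}` is the complex conjugate of `T_{s n ī}`. -/
def theta (g : LocalMetric n) (i j : Fin n) (z : Cn n) : ℂ :=
  (∑ m, ∑ q, upper g m q z * curvature g m q i j z)
  + 1 / 2 * ∑ m, ∑ q, ∑ p, ∑ s,
      upper g m q z * upper g p s z * torsion g p m j z * conj (torsion g s q i z)

end Local

/-! ### Hermitian metrics on a complex manifold -/

section Global

variable {n : ℕ} {M : Type*} [TopologicalSpace M] [ChartedSpace (Cn n) M]

/-- A family of `ℂ`-valued functions of two variables on the holomorphic tangent spaces. -/
abbrev MetricField (n : ℕ) (M : Type*) [TopologicalSpace M] [ChartedSpace (Cn n) M] : Type _ :=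
  ∀ x : M, TangentSpace 𝓘(ℂ, Cn n) x → TangentSpace 𝓘(ℂ, Cn n) x → ℂ

/-- The coefficients `g_{i j̄} = g(∂/∂zᵢ, ∂/∂zⱼ)` in a chart. -/
def coordMetric (g : MetricField n M) (e : OpenPartialHomeomorph M (Cn n)) : LocalMetric n :=
  fun z => Matrix.of fun i j =>
    g (e.symm z) (mfderiv 𝓘(ℂ, Cn n) 𝓘(ℂ, Cn n) e.symm z (stdVec i))
      (mfderiv 𝓘(ℂ, Cn n) 𝓘(ℂ, Cn n) e.symm z (stdVec j))

/-- `g` is a smooth Hermitian metric on the complex manifold `M`, complex linear in the first and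
conjugate linear in the second variable. -/
structure IsHermitianMetric (g : MetricField n M) : Prop where
  add_left : ∀ x v v' w, g x (v + v') w = g x v w + g x v' w
  smul_left : ∀ x (c : ℂ) v w, g x (c • v) w = c * g x v w
  conj_symm : ∀ x v w, g x w v = conj (g x v w)
  pos : ∀ x v, v ≠ 0 → 0 < (g x v v).re
  smooth : ∀ e ∈ IsManifold.maximalAtlas 𝓘(ℂ, Cn n) ω M, ∀ i j,
    ContDiffOn ℝ ∞ (fun z => coordMetric g e z i j) e.target

/-- The identity `Θ(g) = c g` of tensors on `M`: it holds in every holomorphic chart. -/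
def ThetaEqSmul (g : MetricField n M) (c : ℝ) : Prop :=
  ∀ e ∈ IsManifold.maximalAtlas 𝓘(ℂ, Cn n) ω M, ∀ z ∈ e.target, ∀ i j,
    theta (coordMetric g e) i j z = c * coordMetric g e z i j

end Global

/-! ### Homogeneous manifolds and induced metrics -/

section Homogeneous

variable {m n : ℕ} (G : Type*) [TopologicalSpace G] [ChartedSpace (Cn m) G] [Group G]
  (M : Type*) [TopologicalSpace M] [ChartedSpace (Cn n) M] [MulAction G M]

variable {M} in
/-- The evaluation `ev_x : 𝔤 → T_x M`, which sends `X` to the value at `x` of the vector field on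
`M` generated by `X`: it is the differential at `1` of the orbit map `a ↦ a • x`. -/
def ev (x : M) : GroupLieAlgebra 𝓘(ℂ, Cn m) G →L[ℂ] TangentSpace 𝓘(ℂ, Cn n) x :=
  mfderiv 𝓘(ℂ, Cn m) 𝓘(ℂ, Cn n) (fun a : G => a • x) (1 : G)

/-- `M` is the complex homogeneous manifold `G/H`, where `H` is the stabilizer of any point: the
complex Lie group `G` acts on the complex manifold `M` holomorphically and transitively, and the
orbit maps `G → M` (the projections `G → G/H`) are submersions. -/
structure IsHomogeneousManifold (m n : ℕ) (G : Type*) [TopologicalSpace G] [ChartedSpace (Cn m) G]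
    [Group G] (M : Type*) [TopologicalSpace M] [ChartedSpace (Cn n) M] [MulAction G M] : Prop where
  holomorphic : ContMDiffSMul 𝓘(ℂ, Cn m) 𝓘(ℂ, Cn n) ω G M
  transitive : MulAction.IsPretransitive G M
  submersion : ∀ x : M, Function.Surjective (ev (m := m) (n := n) G x)

variable {G M}

open Classical in
/-- The vector in the `h`-orthogonal complement of `ker ev_x` that `ev_x` sends to `v`. -/
def horizontalLift (h : GroupLieAlgebra 𝓘(ℂ, Cn m) G → GroupLieAlgebra 𝓘(ℂ, Cn m) G → ℂ)
    (x : M) (v : TangentSpace 𝓘(ℂ, Cn n) x) : GroupLieAlgebra 𝓘(ℂ, Cn m) G :=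
  if H : ∃ X : GroupLieAlgebra 𝓘(ℂ, Cn m) G,
      (∀ Y : GroupLieAlgebra 𝓘(ℂ, Cn m) G, ev (n := n) G x Y = 0 → h X Y = 0) ∧ ev G x X = v
  then H.choose else 0

/-- The metric `ev_* h` on `M` induced from a Hermitian metric `h` on `𝔤`: the restriction of `h` to
`(ker ev_x)^⊥`, transported to `T_x M` by the isomorphism `ev_x`. -/
def inducedMetric (h : GroupLieAlgebra 𝓘(ℂ, Cn m) G → GroupLieAlgebra 𝓘(ℂ, Cn m) G → ℂ) :
    MetricField n M :=
  fun x v w => h (horizontalLift h x v) (horizontalLift h x w)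

end Homogeneous

/-! ### Invariant metrics on a compact Lie algebra and on its complexification -/

section Algebra

variable {𝔨 : Type*} [LieRing 𝔨] [LieAlgebra ℝ 𝔨]

/-- An invariant metric on a real Lie algebra: an inner product for which all `ad Z` are
skew-symmetric. A simple real Lie algebra is compact exactly if it has one. -/
structure IsInvariantMetric (B : LinearMap.BilinForm ℝ 𝔨) : Prop where
  symm : ∀ X Y, B X Y = B Y X
  pos : ∀ X, X ≠ 0 → 0 < B X X
  invariant : ∀ X Y Z : 𝔨, B ⁅Z, X⁆ Y + B X ⁅Z, Y⁆ = 0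

/-- The sesquilinear extension of `B` to `ℂ ⊗ 𝔨`, with
`(a ⊗ X, b ⊗ Y) ↦ a * conj b * B X Y`. -/
def sesqExtension (B : LinearMap.BilinForm ℝ 𝔨) (Z W : ℂ ⊗[ℝ] 𝔨) : ℂ :=
  B.baseChange ℂ Z (LinearMap.rTensor 𝔨 Complex.conjAe.toLinearMap W)

theorem sesqExtension_tmul (B : LinearMap.BilinForm ℝ 𝔨) (a b : ℂ) (X Y : 𝔨) :
    sesqExtension B (a ⊗ₜ X) (b ⊗ₜ Y) = a * conj b * (B X Y : ℂ) := by
  simp [sesqExtension, mul_comm]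

/-- The Hermitian metric `κ⁻¹` on `𝔤 = ℂ ⊗ 𝔨`: if `κ ∈ Sym^{1,1}(𝔤)` has, in a basis of `𝔨`, the same
matrix as the form on `𝔨*` dual to `B`, then its inverse has the same matrix as `B`. -/
def kappaInv {𝔤 : Type*} [LieRing 𝔤] [LieAlgebra ℂ 𝔤] (B : LinearMap.BilinForm ℝ 𝔨)
    (Φ : (ℂ ⊗[ℝ] 𝔨) ≃ₗ⁅ℂ⁆ 𝔤) (X Y : 𝔤) : ℂ :=
  sesqExtension B (Φ.symm X) (Φ.symm Y)

end Algebra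

end HCF

end

/-! A real `B`-orthonormal basis of `𝔨` is a complex orthonormal basis of `𝔤` for `κ⁻¹`. The vector
fields `sₐ` that it generates on `M` are holomorphic and span every tangent space, and the inverse
of `g₀` is `∑ₐ sₐ ⊗ s̄ₐ`: transporting a form from the orthogonal complement of the kernel amounts
to pushing the dual form forward (`basisForm_coordLift`).

Differentiating (inverse metric) · (metric) = 1 expresses the Christoffel symbols, curvature and
torsion by the `sₐ` and their first derivatives. Put `D_j(c, a) = g(∂_{s_c} sₐ, ∂ⱼ)` and `P(a, c) =
g(s_c, sₐ)`; the matrix `P` is an orthogonal projection. The curvature term of `Θ` is `tr(D_j (1 -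
P) D_i*)`, and the torsion is the antisymmetrization of `D P`. With the coefficient `1/2` the two
add up to `(1/2) ∑ g([sₐ, s_b], ∂ⱼ) conj g([sₐ, s_b], ∂ᵢ)` (`trace_bracket_identity`,
`contraction_identity`).

The brackets of the `sₐ` are, up to a global sign, given by the real structure constants `C` of `𝔨`
(`lieBracket_fundField`). The sum `∑ C_{ab}^p C_{ab}^q` is minus the Killing form, which by Schur's
lemma is a positive multiple of `B` (`exists_smul_eq`), so it equals `2c δ_{pq}`. Since `∑ₚ g(sₚ,
∂ⱼ) conj g(sₚ, ∂ᵢ) = g_{i j̄}`, this gives `Θ(g₀) = c g₀`. -/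

noncomputable section

namespace HCF

/-! ### Invariant metrics and the Killing form -/

section CompactLie

variable {𝔨 : Type*} [LieRing 𝔨] [LieAlgebra ℝ 𝔨]

/-- The inner product space structure given by an invariant metric. -/
@[reducible]
def IsInvariantMetric.innerCore {B : LinearMap.BilinForm ℝ 𝔨} (hB : IsInvariantMetric B) :
    InnerProductSpace.Core ℝ 𝔨 where
  inner X Y := B X Y
  conj_inner_symm X Y := by simp [hB.symm X Y]
  re_inner_nonneg X := by
    by_cases h : X = 0
    · simp [h]
    · simpa using (hB.pos X h).le
  add_left := by simp
  smul_left := by simp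
  definite X h := by
    by_contra h0
    exact (hB.pos X h0).ne' h

/-- An invariant metric has an orthonormal basis. -/
theorem IsInvariantMetric.exists_basis [FiniteDimensional ℝ 𝔨] {B : LinearMap.BilinForm ℝ 𝔨}
    (hB : IsInvariantMetric B) :
    ∃ e : Module.Basis (Fin (Module.finrank ℝ 𝔨)) ℝ 𝔨,
      ∀ a b, B (e a) (e b) = if a = b then 1 else 0 := by
  let _ := hB.innerCore.toNormedAddCommGroup
  let _ : InnerProductSpace ℝ 𝔨 := InnerProductSpace.ofCore hB.innerCore.toCore
  refine ⟨(stdOrthonormalBasis ℝ 𝔨).toBasis, fun a b => ?_⟩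
  have := orthonormal_iff_ite.1 (stdOrthonormalBasis ℝ 𝔨).orthonormal a b
  simpa using! this

/-- A linear map that is symmetric for an invariant metric has an eigenvector. -/
theorem IsInvariantMetric.exists_eigenvector [FiniteDimensional ℝ 𝔨] [Nontrivial 𝔨]
    {B : LinearMap.BilinForm ℝ 𝔨} (hB : IsInvariantMetric B) (A : 𝔨 →ₗ[ℝ] 𝔨)
    (hA : ∀ X Y, B (A X) Y = B X (A Y)) : ∃ c : ℝ, ∃ X, X ≠ 0 ∧ A X = c • X := by
  let _ := hB.innerCore.toNormedAddCommGroup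
  let _ : InnerProductSpace ℝ 𝔨 := InnerProductSpace.ofCore hB.innerCore.toCore
  have hs : A.IsSymmetric := hA
  obtain ⟨X, hX⟩ := hs.hasEigenvalue_iSup_of_finiteDimensional.exists_hasEigenvector
  exact ⟨_, X, hX.2, Module.End.mem_eigenspace_iff.1 hX.1⟩

variable {ι : Type*} [Fintype ι] [DecidableEq ι] {B : LinearMap.BilinForm ℝ 𝔨}

theorem basis_repr_eq_of_orthonormal (e : Module.Basis ι ℝ 𝔨)
    (he : ∀ a b, B (e a) (e b) = if a = b then 1 else 0) (X : 𝔨) (a : ι) :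
    e.repr X a = B X (e a) := by
  conv_rhs => rw [← e.sum_repr X]
  simp only [map_sum, map_smul, LinearMap.sum_apply, LinearMap.smul_apply, he]
  simp

theorem bilinForm_eq_sum_of_orthonormal (e : Module.Basis ι ℝ 𝔨)
    (he : ∀ a b, B (e a) (e b) = if a = b then 1 else 0) (X Y : 𝔨) :
    B X Y = ∑ a, B X (e a) * B Y (e a) := by
  conv_lhs => rw [← e.sum_repr Y]
  simp [basis_repr_eq_of_orthonormal e he, mul_comm]

/-- The Killing form in terms of an orthonormal basis of an invariant metric. -/
theorem IsInvariantMetric.killingForm_eq (hB : IsInvariantMetric B) (e : Module.Basis ι ℝ 𝔨)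
    (he : ∀ a b, B (e a) (e b) = if a = b then 1 else 0) (X Y : 𝔨) :
    killingForm ℝ 𝔨 X Y = -∑ b, B ⁅X, e b⁆ ⁅Y, e b⁆ := by
  rw [killingForm_apply_apply, LinearMap.trace_eq_matrix_trace ℝ e, Matrix.trace,
    ← Finset.sum_neg_distrib]
  refine Finset.sum_congr rfl fun b _ => ?_
  rw [Matrix.diag_apply, LinearMap.toMatrix_apply, basis_repr_eq_of_orthonormal e he]
  -- Skew-symmetry of `ad X` moves the outer bracket of `⁅X, ⁅Y, e b⁆⁆` onto `e b`.
  have := hB.invariant ⁅Y, e b⁆ (e b) X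
  have h2 := hB.symm ⁅X, e b⁆ ⁅Y, e b⁆
  simp only [LinearMap.coe_comp, Function.comp_apply, LieAlgebra.ad_apply]
  linarith

variable [FiniteDimensional ℝ 𝔨] [LieAlgebra.IsSimple ℝ 𝔨]

/-- Minus the Killing form of a compact simple Lie algebra is an invariant metric. -/
theorem IsInvariantMetric.neg_killingForm (hB : IsInvariantMetric B) :
    IsInvariantMetric (-killingForm ℝ 𝔨) := by
  obtain ⟨e, he⟩ := hB.exists_basis
  have key := hB.killingForm_eq e he
  have hB0 : ∀ X, 0 ≤ B X X := fun X => by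
    by_cases h : X = 0
    · simp [h]
    · exact (hB.pos X h).le
  refine ⟨fun X Y => ?_, fun X hX => ?_, fun X Y Z => ?_⟩
  · simp [LieModule.traceForm_comm ℝ 𝔨 𝔨 X Y]
  · simp only [LinearMap.neg_apply, key, neg_neg]
    refine lt_of_le_of_ne (Finset.sum_nonneg fun b _ => hB0 _) fun h => hX ?_
    -- A vanishing sum of squares makes `X` central, and a simple algebra has trivial center.
    have h1 := (Finset.sum_eq_zero_iff_of_nonneg fun b _ => hB0 ⁅X, e b⁆).1 h.symm
    have h2 : ∀ b, ⁅X, e b⁆ = 0 := fun b => by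
      by_contra h0
      exact (hB.pos _ h0).ne' (h1 b (Finset.mem_univ b))
    have h3 : LieAlgebra.ad ℝ 𝔨 X = 0 := e.ext fun b => by simpa using h2 b
    have h4 : X ∈ LieAlgebra.center ℝ 𝔨 := fun Y => by
      have := LinearMap.congr_fun h3 Y
      rw [← lie_skew, neg_eq_zero]
      exact this
    rw [LieAlgebra.center_eq_bot] at h4
    simpa using h4
  · have := LieModule.traceForm_apply_lie_apply' ℝ 𝔨 𝔨 Z X Y
    simp only [LinearMap.neg_apply]
    linarith

/-- Two invariant metrics on a compact simple Lie algebra are proportional. -/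
theorem IsInvariantMetric.exists_smul_eq (hB : IsInvariantMetric B)
    {Q : LinearMap.BilinForm ℝ 𝔨} (hQ : IsInvariantMetric Q) :
    ∃ c : ℝ, 0 < c ∧ ∀ X Y, Q X Y = c * B X Y := by
  obtain ⟨e, he⟩ := hB.exists_basis
  have hnt : Nontrivial 𝔨 := by
    by_contra h
    rw [not_nontrivial_iff_subsingleton] at h
    exact LieAlgebra.IsSimple.non_abelian (R := ℝ) (L := 𝔨) ⟨fun _ _ => Subsingleton.elim _ _⟩
  -- Schur's argument: `A` represents `Q` with respect to `B`. As both forms are invariant, `A`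
  -- commutes with every `ad Z`; as `A` is symmetric, it has a real eigenvalue, whose eigenspace is
  -- a nonzero ideal.
  let A : 𝔨 →ₗ[ℝ] 𝔨 := ∑ a, (Q (e a)).smulRight (e a)
  have hA : ∀ X Y, B (A X) Y = Q X Y := fun X Y => by
    conv_rhs => rw [← e.sum_repr Y]
    simp only [A, LinearMap.sum_apply, LinearMap.smulRight_apply, map_sum, map_smul, smul_eq_mul,
      LinearMap.smul_apply, basis_repr_eq_of_orthonormal e he]
    refine Finset.sum_congr rfl fun a _ => ?_
    rw [hQ.symm (e a) X, hB.symm (e a) Y, mul_comm]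
  have hBext : ∀ X X', (∀ Y, B X Y = B X' Y) → X = X' := fun X X' h => by
    by_contra h0
    have := hB.pos (X - X') (sub_ne_zero.2 h0)
    simp [h] at this
  have hlie : ∀ Z X, A ⁅Z, X⁆ = ⁅Z, A X⁆ := fun Z X => hBext _ _ fun Y => by
    have h1 := hQ.invariant X Y Z
    have h2 := hB.invariant (A X) Y Z
    rw [hA] at h2 ⊢
    linarith
  obtain ⟨c, X₀, hX₀, hc⟩ := hB.exists_eigenvector A fun X Y => by
    rw [hA, hB.symm, hA, hQ.symm]
  let I : LieIdeal ℝ 𝔨 :=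
    { LinearMap.ker (A - c • LinearMap.id) with
      lie_mem := fun {Z X} hX => by
        simp only [AddSubsemigroup.mem_carrier, AddSubmonoid.mem_toSubsemigroup,
          Submodule.mem_toAddSubmonoid, LinearMap.mem_ker, LinearMap.sub_apply,
          LinearMap.smul_apply, LinearMap.id_apply] at hX ⊢
        rw [hlie, sub_eq_zero.1 hX]
        simp }
  have hI : ∀ X, X ∈ I ↔ A X = c • X := fun X => by
    change A X - c • X = 0 ↔ _
    exact sub_eq_zero
  have htop : I = ⊤ := by
    refine (LieAlgebra.IsSimple.eq_bot_or_eq_top I).resolve_left fun h => hX₀ ?_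
    have : X₀ ∈ I := (hI _).2 hc
    rw [h] at this
    simpa using this
  have hall : ∀ X Y, Q X Y = c * B X Y := fun X Y => by
    have : X ∈ I := by rw [htop]; trivial
    rw [← hA, (hI X).1 this]
    simp
  refine ⟨c, ?_, hall⟩
  have h1 := hQ.pos X₀ hX₀
  rw [hall] at h1
  exact pos_of_mul_pos_left h1 (hB.pos X₀ hX₀).le

/-- The structure constants of a compact simple Lie algebra in an orthonormal basis. -/
theorem IsInvariantMetric.exists_structureConstants (hB : IsInvariantMetric B)
    (e : Module.Basis ι ℝ 𝔨) (he : ∀ a b, B (e a) (e b) = if a = b then 1 else 0) :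
    ∃ c : ℝ, 0 < c ∧ ∀ p q, ∑ a, ∑ b, e.repr ⁅e a, e b⁆ p * e.repr ⁅e a, e b⁆ q
      = 2 * c * if p = q then 1 else 0 := by
  obtain ⟨c, hc, h⟩ := hB.exists_smul_eq hB.neg_killingForm
  -- Here `c` is the ratio of minus the Killing form to `B`; halving it matches the normalization `2
  -- * c` of the conclusion.
  refine ⟨c / 2, by positivity, fun p q => ?_⟩
  have hk := hB.killingForm_eq e he (e p) (e q)
  have hh := h (e p) (e q)
  rw [LinearMap.neg_apply, LinearMap.neg_apply, hk, neg_neg, he] at hh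
  -- By invariance the upper index can be rotated into the bracket, so the double sum becomes `∑ₐ B
  -- ⁅e p, e a⁆ ⁅e q, e a⁆`.
  have hr : ∀ a b p, e.repr ⁅e a, e b⁆ p = B ⁅e p, e a⁆ (e b) := fun a b p => by
    rw [basis_repr_eq_of_orthonormal e he, hB.symm]
    have := hB.invariant (e p) (e b) (e a)
    rw [← lie_skew (e p) (e a)]
    simp only [map_neg, LinearMap.neg_apply]
    linarith
  simp only [hr]
  rw [show 2 * (c / 2) = c by ring, ← hh]
  exact Finset.sum_congr rfl fun a _ => (bilinForm_eq_sum_of_orthonormal e he _ _).symm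

end CompactLie

/-! ### Linear algebra of the contraction of curvature and torsion -/

section FrameAlgebra

variable {n : ℕ} {ι : Type*} [Fintype ι]

open Matrix in
/-- The trace identity by which the Chern-Ricci and the torsion terms add up to a sum of squares of
brackets. -/
theorem trace_bracket_identity (P D E : Matrix ι ι ℂ) (hP : Pᴴ = P) (hPP : P * P = P)
    (hD : Pᵀ * D = D) (hE : Pᵀ * E = E) :
    (D * Eᴴ).trace - (D * P * Eᴴ).trace
      + 1 / 2 * (((D * P)ᵀ - D * P) * ((E * P)ᵀ - E * P)ᴴ).trace
      = 1 / 2 * ((D - Dᵀ) * (E - Eᵀ)ᴴ).trace := by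
  have hT : ∀ X Y : Matrix ι ι ℂ, (Xᵀ * (Yᵀ)ᴴ).trace = (X * Yᴴ).trace := fun X Y => by
    rw [← trace_transpose, transpose_mul, transpose_transpose, trace_mul_comm]
    rfl
  have hT2 : ∀ X Y : Matrix ι ι ℂ, (X * (Yᵀ)ᴴ).trace = (Xᵀ * Yᴴ).trace := fun X Y => by
    rw [← hT, transpose_transpose]
  -- After `P * P = P` the two square terms of the torsion trace cancel the subtracted `(D * P *
  -- Eᴴ).trace`. In the mixed terms (`h2`), `Pᵀ * D = D` and `Pᵀ * E = E` remove `P` altogether.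
  have h1 : (D * P * (E * P)ᴴ).trace = (D * P * Eᴴ).trace := by
    rw [conjTranspose_mul, hP, ← Matrix.mul_assoc, Matrix.mul_assoc D, hPP]
  have hEH : Eᴴ * Pᵀ = Eᴴ := by
    conv_rhs => rw [← hE, conjTranspose_mul]
    congr 1
    conv_lhs => rw [← hP]
    rfl
  have h2 : ((D * P)ᵀ * (E * P)ᴴ).trace = (Dᵀ * Eᴴ).trace := by
    have hDT : Dᵀ * P = Dᵀ := by
      conv_rhs => rw [← hD, transpose_mul, transpose_transpose]
    rw [transpose_mul, conjTranspose_mul, hP, Matrix.mul_assoc, trace_mul_comm, ← Matrix.mul_assoc,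
      hDT, Matrix.mul_assoc, hEH]
  simp only [conjTranspose_sub, Matrix.sub_mul, Matrix.mul_sub, trace_sub, hT, hT2, h1, h2]
  ring

/-- Contracting with the inverse metric `∑ s ⊗ s̄` is evaluating on the frame. This trades sums over
coordinates for sums over frame indices, that is for matrix products. -/
theorem sum_sum_gram_mul {κ : Type*} [Fintype κ] (x y : ι → Fin n → ℂ) (f h : κ → Fin n → ℂ) :
    ∑ m, ∑ q, (∑ c, x c m * y c q) * ∑ a, f a m * h a q
      = ∑ c, ∑ a, (∑ m, x c m * f a m) * ∑ q, y c q * h a q := by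
  simp only [Finset.sum_mul_sum]
  calc _ = ∑ m, ∑ c, ∑ q, ∑ a, x c m * y c q * (f a m * h a q) :=
        Finset.sum_congr rfl fun m _ => Finset.sum_comm
    _ = ∑ c, ∑ m, ∑ q, ∑ a, x c m * y c q * (f a m * h a q) := Finset.sum_comm
    _ = ∑ c, ∑ m, ∑ a, ∑ q, x c m * y c q * (f a m * h a q) :=
        Finset.sum_congr rfl fun c _ => Finset.sum_congr rfl fun m _ => Finset.sum_comm
    _ = ∑ c, ∑ a, ∑ m, ∑ q, x c m * y c q * (f a m * h a q) :=
        Finset.sum_congr rfl fun c _ => Finset.sum_comm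
    _ = _ := Finset.sum_congr rfl fun c _ => Finset.sum_congr rfl fun a _ =>
        Finset.sum_congr rfl fun m _ => Finset.sum_congr rfl fun q _ => by ring

/-- The contraction of curvature and torsion, expressed by a holomorphic frame `s` and its
derivatives, in case the inverse metric is `∑ₐ sₐ ⊗ s̄ₐ`. Here `th a j = g(∂ⱼ, sₐ)` and
`E j a m = g(∂ₘ sₐ, ∂ⱼ)`. -/
theorem contraction_identity [DecidableEq ι] (s : ι → Fin n → ℂ) (g : Matrix (Fin n) (Fin n) ℂ)
    (hG : ∀ i j, ∑ l, (∑ a, s a i * conj (s a l)) * g j l = if i = j then 1 else 0)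
    (hg : ∀ i j, conj (g i j) = g j i)
    (E : Fin n → ι → Fin n → ℂ) (th : ι → Fin n → ℂ) (hth : ∀ a j, th a j = ∑ l, conj (s a l) * g j l)
    (P : Matrix ι ι ℂ) (hP : ∀ a c, P a c = ∑ m, s c m * th a m)
    (C : ι → ι → ι → ℝ) (c : ℝ)
    (hC : ∀ p q, ∑ a, ∑ b, C a b p * C a b q = 2 * c * if p = q then 1 else 0)
    (hbr : ∀ a b j, ∑ m, (s a m * E j b m - s b m * E j a m) = ∑ d, C a b d * conj (th d j))
    (i j : Fin n) :
    (∑ m, ∑ q, (∑ a, s a m * conj (s a q)) *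
        ∑ a, E j a m * (conj (E i a q) - ∑ b, conj (P b a) * conj (E i b q)))
      + 1 / 2 * ∑ m, ∑ q, ∑ p, ∑ r, (∑ a, s a m * conj (s a q)) * (∑ a, s a p * conj (s a r)) *
        (-∑ a, (E j a p * th a m - E j a m * th a p)) *
        conj (-∑ a, (E i a r * th a q - E i a q * th a r)) = c * g i j := by
  -- matrix form of the data
  set D : Fin n → Matrix ι ι ℂ := fun j => Matrix.of fun c a => ∑ m, s c m * E j a m with hD
  have hPherm : P.conjTranspose = P := by
    ext a c
    simp only [Matrix.conjTranspose_apply, hP, hth, Finset.mul_sum, star_sum, star_mul']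
    rw [Finset.sum_comm]
    refine Finset.sum_congr rfl fun m _ => Finset.sum_congr rfl fun l _ => ?_
    simp only [RCLike.star_def, RCLike.conj_conj, hg]
    ring
  -- The reproducing formula `v = ∑ g(v, s_b) s_b` at `v = s_c`. It holds although the `s_b` may be
  -- linearly dependent, and it yields both `P * P = P` and `Pᵀ * D = D`.
  have hsP : ∀ c m, ∑ b, P b c * s b m = s c m := fun c m => by
    calc ∑ b, P b c * s b m
        = ∑ b, ∑ k, ∑ l, s c k * (s b m * conj (s b l) * g k l) := by
          refine Finset.sum_congr rfl fun b _ => ?_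
          rw [hP, Finset.sum_mul]
          refine Finset.sum_congr rfl fun k _ => ?_
          rw [hth, Finset.mul_sum, Finset.sum_mul]
          exact Finset.sum_congr rfl fun l _ => by ring
      _ = ∑ k, s c k * ∑ l, (∑ b, s b m * conj (s b l)) * g k l := by
          rw [Finset.sum_comm]
          refine Finset.sum_congr rfl fun k _ => ?_
          rw [Finset.sum_comm, Finset.mul_sum]
          refine Finset.sum_congr rfl fun l _ => ?_
          rw [Finset.sum_mul, Finset.mul_sum]
      _ = s c m := by simp [hG]
  have hPP : P * P = P := by
    ext a c
    rw [Matrix.mul_apply, hP a c]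
    simp only [hP a, Finset.sum_mul]
    rw [Finset.sum_comm]
    refine Finset.sum_congr rfl fun m _ => ?_
    rw [← hsP c m, Finset.sum_mul]
    exact Finset.sum_congr rfl fun b _ => by ring
  have hPD : ∀ j, P.transpose * D j = D j := fun j => by
    ext c a
    simp only [Matrix.mul_apply, Matrix.transpose_apply, hD, Matrix.of_apply, Finset.mul_sum]
    rw [Finset.sum_comm]
    refine Finset.sum_congr rfl fun m _ => ?_
    rw [← hsP c m, Finset.sum_mul]
    exact Finset.sum_congr rfl fun b _ => by ring
  have key := trace_bracket_identity P (D j) (D i) hPherm hPP (hPD j) (hPD i)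
  -- the curvature term
  have hcurv : (∑ m, ∑ q, (∑ a, s a m * conj (s a q)) *
        ∑ a, E j a m * (conj (E i a q) - ∑ b, conj (P b a) * conj (E i b q)))
      = (D j * (D i).conjTranspose).trace - (D j * P * (D i).conjTranspose).trace := by
    rw [sum_sum_gram_mul, Matrix.mul_assoc, ← Matrix.trace_sub, ← Matrix.mul_sub, Matrix.trace]
    refine Finset.sum_congr rfl fun c _ => ?_
    rw [Matrix.diag_apply, Matrix.mul_apply]
    refine Finset.sum_congr rfl fun a _ => ?_
    have h1 : ∀ a, ∑ q, conj (s c q) * conj (E i a q) = (D i).conjTranspose a c := fun a => by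
      simp [hD, Matrix.conjTranspose_apply]
    have h2 : ∀ b, conj (P b a) = P a b := fun b => by
      conv_rhs => rw [← hPherm]
      rfl
    congr 1
    simp only [mul_sub, Finset.sum_sub_distrib, Matrix.sub_apply, h1, Matrix.mul_apply]
    congr 1
    simp only [Finset.mul_sum]
    rw [Finset.sum_comm]
    refine Finset.sum_congr rfl fun b _ => ?_
    rw [← h1, Finset.mul_sum, h2]
    exact Finset.sum_congr rfl fun q _ => by ring
  -- the torsion term
  have htor : ∀ j d c, ∑ m, s c m * ∑ p, s d p * (-∑ a, (E j a p * th a m - E j a m * th a p))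
      = ((D j * P).transpose - D j * P) d c := fun j d c => by
    have h1 : ∀ c d, (D j * P) c d = ∑ m, ∑ p, ∑ a, s c m * s d p * (E j a m * th a p) :=
      fun c d => by
        simp only [Matrix.mul_apply, hD, Matrix.of_apply, hP, Finset.sum_mul_sum]
        rw [Finset.sum_comm]
        refine Finset.sum_congr rfl fun m _ => ?_
        rw [Finset.sum_comm]
        exact Finset.sum_congr rfl fun p _ => Finset.sum_congr rfl fun a _ => by ring
    rw [Matrix.sub_apply, Matrix.transpose_apply, h1 c d, h1 d c,
      Finset.sum_comm (f := fun m p => ∑ a, s d m * s c p * (E j a m * th a p)),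
      ← Finset.sum_sub_distrib]
    refine Finset.sum_congr rfl fun m _ => ?_
    rw [Finset.mul_sum, ← Finset.sum_sub_distrib]
    refine Finset.sum_congr rfl fun p _ => ?_
    rw [← Finset.sum_neg_distrib, Finset.mul_sum, Finset.mul_sum, ← Finset.sum_sub_distrib]
    exact Finset.sum_congr rfl fun a _ => by ring
  have htors : ∑ m, ∑ q, ∑ p, ∑ r, (∑ a, s a m * conj (s a q)) * (∑ a, s a p * conj (s a r)) *
        (-∑ a, (E j a p * th a m - E j a m * th a p)) *
        conj (-∑ a, (E i a r * th a q - E i a q * th a r))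
      = (((D j * P).transpose - D j * P) * ((D i * P).transpose - D i * P).conjTranspose).trace := by
    set T : Fin n → Fin n → Fin n → ℂ :=
      fun j p m => -∑ a, (E j a p * th a m - E j a m * th a p) with hT
    have h1 : ∀ m q, ∑ p, ∑ r, (∑ a, s a m * conj (s a q)) * (∑ a, s a p * conj (s a r)) *
        T j p m * conj (T i r q) = (∑ a, s a m * conj (s a q)) *
          ∑ d, (∑ p, s d p * T j p m) * conj (∑ r, s d r * T i r q) := fun m q => by
      -- The index type `Unit` specializes the contraction to a single product instead of a sum.
      have := sum_sum_gram_mul (κ := Unit) s (fun c q => conj (s c q)) (fun _ p => T j p m)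
        (fun _ r => conj (T i r q))
      simp only [Finset.univ_unique, Finset.sum_singleton] at this
      simp only [map_sum, map_mul]
      rw [← this, Finset.mul_sum]
      refine Finset.sum_congr rfl fun p _ => ?_
      rw [Finset.mul_sum]
      exact Finset.sum_congr rfl fun r _ => by ring
    calc _ = ∑ m, ∑ q, (∑ a, s a m * conj (s a q)) *
          ∑ d, (∑ p, s d p * T j p m) * conj (∑ r, s d r * T i r q) :=
          Finset.sum_congr rfl fun m _ => Finset.sum_congr rfl fun q _ => h1 m q
      _ = _ := by
          rw [sum_sum_gram_mul, Finset.sum_comm, Matrix.trace]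
          refine Finset.sum_congr rfl fun d _ => ?_
          rw [Matrix.diag_apply, Matrix.mul_apply]
          refine Finset.sum_congr rfl fun c _ => ?_
          rw [Matrix.conjTranspose_apply, ← htor j d c, ← htor i d c, RCLike.star_def, map_sum]
          simp only [map_mul, hT]
  rw [hcurv, htors, key]
  have hbr' : ∀ a b j, (D j - (D j).transpose) a b = ∑ d, C a b d * conj (th d j) := fun a b j => by
    rw [← hbr, Finset.sum_sub_distrib]
    rfl
  -- Parseval's identity: lowering both indices of the inverse metric `∑ s ⊗ s̄` gives back `g`.
  have hthth : ∑ d, conj (th d j) * th d i = g i j := by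
    calc _ = ∑ d, ∑ l, ∑ r, g l j * (s d l * conj (s d r) * g i r) := by
          refine Finset.sum_congr rfl fun d _ => ?_
          simp only [hth, map_sum, map_mul, hg, RCLike.conj_conj, Finset.sum_mul_sum]
          exact Finset.sum_congr rfl fun l _ => Finset.sum_congr rfl fun r _ => by ring
      _ = ∑ l, g l j * ∑ r, (∑ d, s d l * conj (s d r)) * g i r := by
          rw [Finset.sum_comm]
          refine Finset.sum_congr rfl fun l _ => ?_
          rw [Finset.sum_comm, Finset.mul_sum]
          refine Finset.sum_congr rfl fun r _ => ?_
          rw [Finset.sum_mul, Finset.mul_sum]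
      _ = g i j := by simp [hG]
  calc _ = 1 / 2 * ∑ a, ∑ b, ∑ p, ∑ q,
        (C a b p * C a b q : ℂ) * (conj (th p j) * th q i) := by
        rw [Matrix.trace]
        congr 1
        refine Finset.sum_congr rfl fun a _ => ?_
        rw [Matrix.diag_apply, Matrix.mul_apply]
        refine Finset.sum_congr rfl fun b _ => ?_
        rw [Matrix.conjTranspose_apply, hbr', hbr', RCLike.star_def, map_sum, Finset.sum_mul_sum]
        refine Finset.sum_congr rfl fun p _ => Finset.sum_congr rfl fun q _ => ?_
        simp only [map_mul, Complex.conj_ofReal, RCLike.conj_conj]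
        ring
    _ = 1 / 2 * ∑ p, ∑ q, ((∑ a, ∑ b, C a b p * C a b q : ℝ) : ℂ) * (conj (th p j) * th q i) := by
        congr 1
        calc _ = ∑ a, ∑ p, ∑ b, ∑ q, (C a b p * C a b q : ℂ) * (conj (th p j) * th q i) :=
              Finset.sum_congr rfl fun a _ => Finset.sum_comm
          _ = ∑ p, ∑ a, ∑ b, ∑ q, (C a b p * C a b q : ℂ) * (conj (th p j) * th q i) :=
              Finset.sum_comm
          _ = ∑ p, ∑ a, ∑ q, ∑ b, (C a b p * C a b q : ℂ) * (conj (th p j) * th q i) :=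
              Finset.sum_congr rfl fun p _ => Finset.sum_congr rfl fun a _ => Finset.sum_comm
          _ = ∑ p, ∑ q, ∑ a, ∑ b, (C a b p * C a b q : ℂ) * (conj (th p j) * th q i) :=
              Finset.sum_congr rfl fun p _ => Finset.sum_comm
          _ = _ := by
              push_cast
              simp only [Finset.sum_mul]
    _ = c * g i j := by
        simp only [hC, Complex.ofReal_mul, Complex.ofReal_ofNat, apply_ite Complex.ofReal,
          Complex.ofReal_one, Complex.ofReal_zero]
        simp only [mul_ite, mul_one, mul_zero, ite_mul, zero_mul, Finset.sum_ite_eq,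
          Finset.mem_univ, if_true]
        rw [← Finset.mul_sum, hthth]
        ring

end FrameAlgebra

/-! ### Wirtinger calculus -/

section Wirtinger

open Filter Topology

variable {n : ℕ} {f g : Cn n → ℂ} {z : Cn n} (i : Fin n)

theorem dz_congr (h : f =ᶠ[𝓝 z] g) : dz i f z = dz i g z := by
  simp only [dz, h.fderiv_eq]

theorem dzBar_congr (h : f =ᶠ[𝓝 z] g) : dzBar i f z = dzBar i g z := by
  simp only [dzBar, h.fderiv_eq]

theorem dz_const (c : ℂ) : dz i (fun _ => c) z = 0 := by simp [dz]

theorem dzBar_const (c : ℂ) : dzBar i (fun _ => c) z = 0 := by simp [dzBar]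

theorem dz_mul (hf : DifferentiableAt ℝ f z) (hg : DifferentiableAt ℝ g z) :
    dz i (fun w => f w * g w) z = dz i f z * g z + f z * dz i g z := by
  simp only [dz, fderiv_fun_mul hf hg, add_apply,
    smul_apply, smul_eq_mul]
  ring

theorem dzBar_mul (hf : DifferentiableAt ℝ f z) (hg : DifferentiableAt ℝ g z) :
    dzBar i (fun w => f w * g w) z = dzBar i f z * g z + f z * dzBar i g z := by
  simp only [dzBar, fderiv_fun_mul hf hg, add_apply,
    smul_apply, smul_eq_mul]
  ring

theorem dz_sum {ι : Type*} (u : Finset ι) {F : ι → Cn n → ℂ}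
    (hF : ∀ a ∈ u, DifferentiableAt ℝ (F a) z) :
    dz i (fun w => ∑ a ∈ u, F a w) z = ∑ a ∈ u, dz i (F a) z := by
  simp only [dz, fderiv_fun_sum hF, sum_apply, Finset.mul_sum,
    ← Finset.sum_sub_distrib, Finset.sum_div]

theorem dzBar_sum {ι : Type*} (u : Finset ι) {F : ι → Cn n → ℂ}
    (hF : ∀ a ∈ u, DifferentiableAt ℝ (F a) z) :
    dzBar i (fun w => ∑ a ∈ u, F a w) z = ∑ a ∈ u, dzBar i (F a) z := by
  simp only [dzBar, fderiv_fun_sum hF, sum_apply, Finset.mul_sum,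
    ← Finset.sum_add_distrib, Finset.sum_div]

theorem dz_sum_mul {ι : Type*} [Fintype ι] {F H : ι → Cn n → ℂ}
    (hF : ∀ a, DifferentiableAt ℝ (F a) z) (hH : ∀ a, DifferentiableAt ℝ (H a) z) :
    dz i (fun w => ∑ a, F a w * H a w) z
      = ∑ a, (dz i (F a) z * H a z + F a z * dz i (H a) z) := by
  rw [dz_sum i _ fun a _ => (hF a).fun_mul (hH a)]
  exact Finset.sum_congr rfl fun a _ => dz_mul i (hF a) (hH a)

theorem dzBar_sum_mul {ι : Type*} [Fintype ι] {F H : ι → Cn n → ℂ}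
    (hF : ∀ a, DifferentiableAt ℝ (F a) z) (hH : ∀ a, DifferentiableAt ℝ (H a) z) :
    dzBar i (fun w => ∑ a, F a w * H a w) z
      = ∑ a, (dzBar i (F a) z * H a z + F a z * dzBar i (H a) z) := by
  rw [dzBar_sum i _ fun a _ => (hF a).fun_mul (hH a)]
  exact Finset.sum_congr rfl fun a _ => dzBar_mul i (hF a) (hH a)

theorem dzBar_neg : dzBar i (fun w => -f w) z = -dzBar i f z := by
  simp only [dzBar, fderiv_fun_neg, neg_apply]
  ring

theorem fderiv_conj_apply (v : Cn n) :
    fderiv ℝ (fun w => conj (f w)) z v = conj (fderiv ℝ f z v) := by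
  have := Complex.conjCLE.comp_fderiv (f := f) (x := z)
  exact DFunLike.congr_fun this v

theorem dz_conj : dz i (fun w => conj (f w)) z = conj (dzBar i f z) := by
  simp only [dz, dzBar, fderiv_conj_apply, map_div₀, map_add, map_mul, Complex.conj_I,
    Complex.conj_ofNat]
  ring

theorem dzBar_conj : dzBar i (fun w => conj (f w)) z = conj (dz i f z) := by
  simp only [dz, dzBar, fderiv_conj_apply, map_div₀, map_sub, map_mul, Complex.conj_I,
    Complex.conj_ofNat]
  ring

theorem dz_eq_fderiv (hf : DifferentiableAt ℂ f z) : dz i f z = fderiv ℂ f z (stdVec i) := by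
  simp only [dz, hf.fderiv_restrictScalars ℝ, ContinuousLinearMap.coe_restrictScalars', map_smul,
    smul_eq_mul]
  linear_combination (-fderiv ℂ f z (stdVec i) / 2) * Complex.I_sq

theorem dzBar_eq_zero (hf : DifferentiableAt ℂ f z) : dzBar i f z = 0 := by
  simp only [dzBar, hf.fderiv_restrictScalars ℝ, ContinuousLinearMap.coe_restrictScalars', map_smul,
    smul_eq_mul]
  linear_combination (fderiv ℂ f z (stdVec i) / 2) * Complex.I_sq

/-- Near `z` the Wirtinger derivative is a component of the complex derivative, which is again
holomorphic. The curvature needs this, so that `∂̄` does not see the derivatives of the frame. -/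
theorem differentiableAt_dz (hf : ContDiffAt ℂ ω f z) : DifferentiableAt ℂ (dz i f) z := by
  have h1 : ∀ᶠ w in 𝓝 z, dz i f w = fderiv ℂ f w (stdVec i) :=
    (hf.eventually (by simp)).mono fun w hw => dz_eq_fderiv i (hw.differentiableAt (by simp))
  have h2 : ContDiffAt ℂ ω (fderiv ℂ f) z := hf.fderiv_right (by simp)
  exact ((h2.differentiableAt (by simp)).clm_apply (differentiableAt_const _)).congr_of_eventuallyEq
    h1

theorem differentiableAt_conj (hf : DifferentiableAt ℝ f z) :
    DifferentiableAt ℝ (fun w => conj (f w)) z :=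
  Complex.conjCLE.differentiableAt.comp z hf

end Wirtinger

/-! ### Smoothness of the inverse matrix -/

section MatrixSmooth

variable {E : Type*} [NormedAddCommGroup E] [NormedSpace ℝ E] {n : ℕ} {r : WithTop ℕ∞}
  {A : E → Matrix (Fin n) (Fin n) ℂ} {z : E}

theorem contDiffAt_det (hA : ∀ i j, ContDiffAt ℝ r (fun w => A w i j) z) :
    ContDiffAt ℝ r (fun w => (A w).det) z := by
  simp only [Matrix.det_apply]
  exact ContDiffAt.sum fun σ _ => (contDiffAt_prod fun i _ => hA _ _).const_smul _

/-- Cramer's rule: entries of the adjugate are determinants of `A` with one row made constant. -/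
theorem contDiffAt_inv (hA : ∀ i j, ContDiffAt ℝ r (fun w => A w i j) z)
    (h : IsUnit (A z).det) (i j : Fin n) : ContDiffAt ℝ r (fun w => (A w)⁻¹ i j) z := by
  simp only [Matrix.inv_def, Matrix.smul_apply, smul_eq_mul, Ring.inverse_eq_inv',
    Matrix.adjugate_apply]
  refine ((contDiffAt_det hA).inv h.ne_zero).mul (contDiffAt_det fun k l => ?_)
  by_cases hk : k = j
  · subst hk
    simpa using contDiffAt_const
  · simpa [Matrix.updateRow_ne hk] using hA k l

end MatrixSmooth

/-! ### Chern geometry of a metric with inverse `∑ₐ sₐ ⊗ s̄ₐ` -/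

section Frame

variable {n : ℕ} {ι : Type*} [Fintype ι]

/-- The contravariant tensor `∑ₐ sₐ ⊗ s̄ₐ` of vectors `sₐ`. -/
def vecGram (s : ι → Fin n → ℂ) : Matrix (Fin n) (Fin n) ℂ :=
  Matrix.of fun i j => ∑ a, s a i * conj (s a j)

theorem conjTranspose_vecGram (s : ι → Fin n → ℂ) : (vecGram s).conjTranspose = vecGram s := by
  ext i j
  simp only [vecGram, Matrix.conjTranspose_apply, Matrix.of_apply, star_sum, star_mul',
    RCLike.star_def, RCLike.conj_conj]
  exact Finset.sum_congr rfl fun a _ => mul_comm _ _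

/-- The contravariant tensor `∑ₐ sₐ ⊗ s̄ₐ` of vector fields `sₐ`. -/
def gram (s : ι → Fin n → Cn n → ℂ) (z : Cn n) : Matrix (Fin n) (Fin n) ℂ :=
  vecGram fun a i => s a i z

variable {s : ι → Fin n → Cn n → ℂ} {g : LocalMetric n} {z : Cn n}

theorem contDiffAt_gram (hs : ∀ a i, ContDiffAt ℂ ω (s a i) z) (i j : Fin n) :
    ContDiffAt ℝ ω (fun w => gram s w i j) z :=
  ContDiffAt.sum fun a _ => ((hs a i).restrict_scalars ℝ).mul
    (Complex.conjCLE.contDiff.contDiffAt.comp z ((hs a j).restrict_scalars ℝ))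

/-- The factors `s̄ₐ` are antiholomorphic, so `∂` sees only the `sₐ`. -/
theorem dz_gram (hs : ∀ a i, ContDiffAt ℂ ω (s a i) z) (q i j : Fin n) :
    dz q (fun w => gram s w i j) z = ∑ a, dz q (s a i) z * conj (s a j z) := by
  have hd : ∀ a i, DifferentiableAt ℂ (s a i) z := fun a i => (hs a i).differentiableAt (by simp)
  have hr : ∀ a i, DifferentiableAt ℝ (s a i) z := fun a i => (hd a i).restrictScalars ℝ
  simp only [gram, vecGram, Matrix.of_apply]
  rw [dz_sum_mul q (fun a => hr a i) fun a => differentiableAt_conj (hr a j)]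
  refine Finset.sum_congr rfl fun a _ => ?_
  rw [dz_conj, dzBar_eq_zero q (hd a j)]
  simp

theorem dzBar_gram (hs : ∀ a i, ContDiffAt ℂ ω (s a i) z) (q i j : Fin n) :
    dzBar q (fun w => gram s w i j) z = ∑ a, s a i z * conj (dz q (s a j) z) := by
  have hd : ∀ a i, DifferentiableAt ℂ (s a i) z := fun a i => (hs a i).differentiableAt (by simp)
  have hr : ∀ a i, DifferentiableAt ℝ (s a i) z := fun a i => (hd a i).restrictScalars ℝ
  simp only [gram, vecGram, Matrix.of_apply]
  rw [dzBar_sum_mul q (fun a => hr a i) fun a => differentiableAt_conj (hr a j)]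
  refine Finset.sum_congr rfl fun a _ => ?_
  rw [dzBar_conj, dzBar_eq_zero q (hd a i)]
  simp

/-- On `U`, the inverse of the metric `g` is the tensor `∑ₐ sₐ ⊗ s̄ₐ` of the holomorphic vector
fields `sₐ`. -/
structure IsFrameOn (s : ι → Fin n → Cn n → ℂ) (g : LocalMetric n) (U : Set (Cn n)) : Prop where
  isOpen : IsOpen U
  holomorphic : ∀ z ∈ U, ∀ a i, ContDiffAt ℂ ω (s a i) z
  isUnit_det : ∀ z ∈ U, IsUnit (gram s z).det
  metric_eq : ∀ z ∈ U, g z = ((gram s z)⁻¹).transpose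

/-- The functions `g(∂ⱼ, sₐ)`. -/
def coframe (s : ι → Fin n → Cn n → ℂ) (g : LocalMetric n) (a : ι) (j : Fin n) (z : Cn n) : ℂ :=
  ∑ l, conj (s a l z) * g z j l

/-- The functions `g(∂ₘ sₐ, ∂ⱼ)`. -/
def lowerDeriv (s : ι → Fin n → Cn n → ℂ) (g : LocalMetric n) (z : Cn n) (j : Fin n) (a : ι)
    (m : Fin n) : ℂ :=
  ∑ l, dz m (s a l) z * g z l j

namespace IsFrameOn

variable {U : Set (Cn n)} (h : IsFrameOn s g U) (hz : z ∈ U)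

include h hz

theorem eventually_mem : ∀ᶠ w in nhds z, w ∈ U := h.isOpen.mem_nhds hz

theorem sum_gram_mul (i j : Fin n) : ∑ l, gram s z i l * g z j l = if i = j then 1 else 0 := by
  have := Matrix.mul_nonsing_inv (gram s z) (h.isUnit_det z hz)
  rw [h.metric_eq z hz, ← Matrix.one_apply, ← this]
  rfl

theorem upper_eq (i j : Fin n) : upper g i j z = gram s z i j := by
  rw [upper, h.metric_eq z hz, ← Matrix.transpose_nonsing_inv,
    Matrix.nonsing_inv_nonsing_inv _ (h.isUnit_det z hz)]
  rfl

theorem conj_metric (i j : Fin n) : conj (g z i j) = g z j i := by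
  have h2 : ((gram s z)⁻¹).conjTranspose = (gram s z)⁻¹ := by
    rw [Matrix.conjTranspose_nonsing_inv, gram, conjTranspose_vecGram]
  rw [h.metric_eq z hz, Matrix.transpose_apply, Matrix.transpose_apply]
  conv_rhs => rw [← h2]
  rfl

theorem contDiffAt_metric (i j : Fin n) : ContDiffAt ℝ ω (fun w => g w i j) z := by
  refine (contDiffAt_inv (contDiffAt_gram (h.holomorphic z hz)) (h.isUnit_det z hz) j
    i).congr_of_eventuallyEq ?_
  filter_upwards [h.eventually_mem hz] with w hw
  rw [h.metric_eq w hw, Matrix.transpose_apply]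

/-- Differentiating `∑ₗ g^{k l̄} g_{j l̄} = δ` moves the derivative from the metric to its inverse.
-/
theorem christoffel_eq (k i j : Fin n) :
    christoffel g k i j z = -∑ a, dz i (s a k) z * coframe s g a j z := by
  have hG : ∀ i j, DifferentiableAt ℝ (fun w => gram s w i j) z := fun i j =>
    (contDiffAt_gram (h.holomorphic z hz) i j).differentiableAt (by simp)
  have hg : ∀ i j, DifferentiableAt ℝ (fun w => g w i j) z := fun i j =>
    (h.contDiffAt_metric hz i j).differentiableAt (by simp)
  have h1 : dz i (fun w => ∑ l, gram s w k l * g w j l) z = 0 := by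
    rw [dz_congr (g := fun _ => if k = j then 1 else 0), dz_const]
    filter_upwards [h.eventually_mem hz] with w hw using h.sum_gram_mul hw k j
  rw [dz_sum_mul i (hG k) (hg j)] at h1
  simp only [Finset.sum_add_distrib,
    dz_gram (h.holomorphic z hz)] at h1
  simp only [christoffel, h.upper_eq hz]
  rw [← sub_eq_zero, sub_neg_eq_add, ← h1, add_comm]
  congr 1
  simp only [coframe, Finset.sum_mul, Finset.mul_sum]
  rw [Finset.sum_comm]
  exact Finset.sum_congr rfl fun l _ => Finset.sum_congr rfl fun a _ => by ring

theorem conj_lowerDeriv (j : Fin n) (a : ι) (m : Fin n) :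
    conj (lowerDeriv s g z j a m) = ∑ l, conj (dz m (s a l) z) * g z j l := by
  simp only [lowerDeriv, map_sum, map_mul, h.conj_metric hz]

theorem conj_coframe (a : ι) (j : Fin n) :
    conj (coframe s g a j z) = ∑ l, s a l z * g z l j := by
  simp only [coframe, map_sum, map_mul, h.conj_metric hz, RCLike.conj_conj]

/-- The derivative of the same relation, solved for `∂̄g` by contracting once more with `g`. -/
theorem dzBar_metric (q j m : Fin n) :
    dzBar q (fun w => g w j m) z
      = -∑ b, conj (coframe s g b m z) * conj (lowerDeriv s g z j b q) := by
  have hG : ∀ i j, DifferentiableAt ℝ (fun w => gram s w i j) z := fun i j =>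
    (contDiffAt_gram (h.holomorphic z hz) i j).differentiableAt (by simp)
  have hg : ∀ i j, DifferentiableAt ℝ (fun w => g w i j) z := fun i j =>
    (h.contDiffAt_metric hz i j).differentiableAt (by simp)
  have h1 : ∀ k, ∑ l, gram s z k l * dzBar q (fun w => g w j l) z
      = -∑ b, s b k z * conj (lowerDeriv s g z j b q) := fun k => by
    have h1 : dzBar q (fun w => ∑ l, gram s w k l * g w j l) z = 0 := by
      rw [dzBar_congr (g := fun _ => if k = j then 1 else 0), dzBar_const]
      filter_upwards [h.eventually_mem hz] with w hw using h.sum_gram_mul hw k j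
    rw [dzBar_sum_mul q (hG k) (hg j)] at h1
    simp only [Finset.sum_add_distrib,
      dzBar_gram (h.holomorphic z hz)] at h1
    rw [← sub_eq_zero, sub_neg_eq_add, ← h1, add_comm]
    congr 1
    simp only [h.conj_lowerDeriv hz, Finset.sum_mul, Finset.mul_sum]
    rw [Finset.sum_comm]
    exact Finset.sum_congr rfl fun l _ => Finset.sum_congr rfl fun a _ => by ring
  have h2 : ∀ l, ∑ k, g z k m * gram s z k l = if m = l then 1 else 0 := fun l => by
    have h3 := Matrix.nonsing_inv_mul (gram s z) (h.isUnit_det z hz)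
    rw [h.metric_eq z hz, ← Matrix.one_apply, ← h3]
    rfl
  calc dzBar q (fun w => g w j m) z
      = ∑ l, (∑ k, g z k m * gram s z k l) * dzBar q (fun w => g w j l) z := by simp [h2]
    _ = ∑ k, g z k m * ∑ l, gram s z k l * dzBar q (fun w => g w j l) z := by
        simp only [Finset.sum_mul, Finset.mul_sum]
        rw [Finset.sum_comm]
        exact Finset.sum_congr rfl fun l _ => Finset.sum_congr rfl fun a _ => by ring
    _ = _ := by
        simp only [h1, h.conj_coframe hz, Finset.sum_mul, Finset.mul_sum, mul_neg,
          Finset.sum_neg_distrib]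
        rw [Finset.sum_comm]
        congr 1
        exact Finset.sum_congr rfl fun l _ => Finset.sum_congr rfl fun a _ => by ring

theorem differentiableAt_coframe (a : ι) (j : Fin n) :
    DifferentiableAt ℝ (coframe s g a j) z :=
  DifferentiableAt.fun_sum fun l _ => (differentiableAt_conj
    (((h.holomorphic z hz a l).differentiableAt (by simp)).restrictScalars ℝ)).mul
    ((h.contDiffAt_metric hz j l).differentiableAt (by simp))

/-- In the product rule for `g(∂ⱼ, sₐ)` the derivative of `g` subtracts the image under the
projection `P`; this is the source of the factor `1 - P` in the curvature term. -/
theorem dzBar_coframe (q : Fin n) (a : ι) (j : Fin n) :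
    dzBar q (coframe s g a j) z = conj (lowerDeriv s g z j a q)
      - ∑ b, conj (∑ m, s a m z * coframe s g b m z) * conj (lowerDeriv s g z j b q) := by
  have hc : ∀ l, DifferentiableAt ℝ (fun w => conj (s a l w)) z := fun l => differentiableAt_conj
    (((h.holomorphic z hz a l).differentiableAt (by simp)).restrictScalars ℝ)
  have hg : ∀ i j, DifferentiableAt ℝ (fun w => g w i j) z := fun i j =>
    (h.contDiffAt_metric hz i j).differentiableAt (by simp)
  have h1 : dzBar q (coframe s g a j) z = _ := dzBar_sum_mul q hc (hg j)
  rw [h1]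
  simp only [Finset.sum_add_distrib, dzBar_conj,
    h.dzBar_metric hz]
  rw [← h.conj_lowerDeriv hz, sub_eq_add_neg]
  congr 1
  simp only [map_sum (starRingEnd ℂ) (fun m => s a m z * _), map_mul, Finset.sum_mul, Finset.mul_sum,
    mul_neg, Finset.sum_neg_distrib]
  rw [Finset.sum_comm]
  congr 1
  exact Finset.sum_congr rfl fun l _ => Finset.sum_congr rfl fun a _ => by ring

/-- Coordinate fields are holomorphic, so the curvature is `-∂̄Γ`; the derivatives `∂ₘ sₐ` inside
`Γ` are holomorphic too, and only the coframe gets differentiated. -/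
theorem curvature_eq (m q i j : Fin n) :
    curvature g m q i j z = ∑ a, lowerDeriv s g z j a m * (conj (lowerDeriv s g z i a q)
      - ∑ b, conj (∑ m, s a m z * coframe s g b m z) * conj (lowerDeriv s g z i b q)) := by
  have hn : ∀ m j (w : Cn n) p, nabla g m (coordField j) w p = christoffel g p m j w := by
    intro m j w p
    simp [nabla, coordField, dz_const, Pi.single_apply]
  have hb : ∀ p, nabla g m (nablaBar q (coordField i)) z p = 0 := by
    intro p
    have : nablaBar q (coordField (n := n) i) = fun _ _ => 0 := by
      ext w k
      simp [nablaBar, coordField, dzBar_const]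
    simp [this, nabla, dz_const]
  have hd : ∀ a k, DifferentiableAt ℂ (dz m (s a k)) z := fun a k =>
    differentiableAt_dz m (h.holomorphic z hz a k)
  have hr : ∀ a k, DifferentiableAt ℝ (dz m (s a k)) z := fun a k => (hd a k).restrictScalars ℝ
  have hc : ∀ p, nablaBar q (nabla g m (coordField i)) z p
      = -∑ a, dz m (s a p) z * dzBar q (coframe s g a i) z := by
    intro p
    rw [nablaBar, dzBar_congr (g := fun w => -∑ a, dz m (s a p) w * coframe s g a i w), dzBar_neg,
      dzBar_sum_mul q (fun a => hr a p) fun a => h.differentiableAt_coframe hz a i]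
    · congr 1
      refine Finset.sum_congr rfl fun a _ => ?_
      rw [dzBar_eq_zero q (hd a p)]
      simp
    · filter_upwards [h.eventually_mem hz] with w hw
      rw [hn, h.christoffel_eq hw]
  simp only [curvature, hb, hc, zero_sub, neg_neg, ← h.dzBar_coframe hz]
  simp only [lowerDeriv, Finset.sum_mul]
  rw [Finset.sum_comm]
  exact Finset.sum_congr rfl fun l _ => Finset.sum_congr rfl fun a _ => by ring

theorem torsion_eq (i j l : Fin n) :
    torsion g i j l z = -∑ a, (lowerDeriv s g z l a i * coframe s g a j z
      - lowerDeriv s g z l a j * coframe s g a i z) := by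
  have hn : ∀ m j (w : Cn n) p, nabla g m (coordField j) w p = christoffel g p m j w := by
    intro m j w p
    simp [nabla, coordField, dz_const, Pi.single_apply]
  have hk : ∀ i j, ∑ p, christoffel g p i j z * g z p l
      = -∑ a, lowerDeriv s g z l a i * coframe s g a j z := fun i j => by
    simp only [h.christoffel_eq hz, lowerDeriv, Finset.sum_mul, neg_mul, Finset.sum_neg_distrib]
    rw [Finset.sum_comm]
    congr 1
    exact Finset.sum_congr rfl fun l _ => Finset.sum_congr rfl fun a _ => by ring
  simp only [torsion, hn, sub_mul, Finset.sum_sub_distrib, hk]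
  ring

/-- A metric whose inverse is `∑ₐ sₐ ⊗ s̄ₐ`, where the `sₐ` span a Lie algebra with structure
constants `C`, satisfies `Θ(g) = c g` as soon as `∑ C_{ab}^p C_{ab}^q = 2 c δ_{pq}`. -/
theorem theta_eq [DecidableEq ι] (C : ι → ι → ι → ℝ) (c : ℝ)
    (hC : ∀ p q, ∑ a, ∑ b, C a b p * C a b q = 2 * c * if p = q then 1 else 0)
    (hbr : ∀ a b k, ∑ m, (s a m z * dz m (s b k) z - s b m z * dz m (s a k) z)
      = ∑ d, C a b d * s d k z) (i j : Fin n) :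
    theta g i j z = c * g z i j := by
  have key := contraction_identity (fun a k => s a k z) (g z) (h.sum_gram_mul hz)
    (h.conj_metric hz) (lowerDeriv s g z) (fun a j => coframe s g a j z) (fun _ _ => rfl)
    (Matrix.of fun a c => ∑ m, s c m z * coframe s g a m z) (fun _ _ => rfl) C c hC
    (fun a b j => by
      simp only [h.conj_coframe hz, lowerDeriv]
      calc _ = ∑ k, (∑ m, (s a m z * dz m (s b k) z - s b m z * dz m (s a k) z)) * g z k j := by
            simp only [Finset.mul_sum, Finset.sum_mul, ← Finset.sum_sub_distrib]
            rw [Finset.sum_comm]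
            exact Finset.sum_congr rfl fun l _ => Finset.sum_congr rfl fun a _ => by ring
        _ = _ := by
            simp only [hbr, Finset.mul_sum, Finset.sum_mul]
            rw [Finset.sum_comm]
            exact Finset.sum_congr rfl fun l _ => Finset.sum_congr rfl fun a _ => by ring) i j
  rw [← key]
  simp only [theta, h.upper_eq hz, h.curvature_eq hz, h.torsion_eq hz]
  rfl

end IsFrameOn

end Frame

/-! ### Orthogonal lifts and the Gram tensor -/

section Lift

variable {n : ℕ} {ι : Type*} [Fintype ι] {V W : Type*} [AddCommGroup V] [Module ℂ V]
  [AddCommGroup W] [Module ℂ W] (b : Module.Basis ι ℂ V) (T : V →ₗ[ℂ] W)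

/-- The Hermitian form for which the basis `b` is orthonormal. -/
def basisForm (X Y : V) : ℂ := ∑ a, b.repr X a * conj (b.repr Y a)

theorem basisForm_sub_left (X X' Y : V) :
    basisForm b (X - X') Y = basisForm b X Y - basisForm b X' Y := by
  simp [basisForm, sub_mul, Finset.sum_sub_distrib]

theorem basisForm_add_left (X X' Y : V) :
    basisForm b (X + X') Y = basisForm b X Y + basisForm b X' Y := by
  simp [basisForm, add_mul, Finset.sum_add_distrib]

theorem basisForm_smul_left (c : ℂ) (X Y : V) :
    basisForm b (c • X) Y = c * basisForm b X Y := by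
  simp [basisForm, mul_assoc, Finset.mul_sum]

theorem basisForm_conj_symm (X Y : V) : basisForm b Y X = conj (basisForm b X Y) := by
  simp only [basisForm, map_sum, map_mul, RCLike.conj_conj]
  exact Finset.sum_congr rfl fun a _ => mul_comm _ _

theorem basisForm_self (X : V) : basisForm b X X = ∑ a, ‖b.repr X a‖ ^ 2 := by
  simp [basisForm, Complex.mul_conj, Complex.normSq_eq_norm_sq]

theorem basisForm_self_pos {X : V} (hX : X ≠ 0) : 0 < (basisForm b X X).re := by
  rw [basisForm_self, Complex.ofReal_re]
  obtain ⟨a, ha⟩ : ∃ a, b.repr X a ≠ 0 := by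
    by_contra! h
    exact hX (b.repr.map_eq_zero_iff.1 (Finsupp.ext h))
  exact Finset.sum_pos' (fun a _ => by positivity) ⟨a, Finset.mem_univ a, by positivity⟩

/-- `X` is the lift of `v` to the orthogonal complement of the kernel of `T`. -/
def IsLift (v : W) (X : V) : Prop := (∀ Y, T Y = 0 → basisForm b X Y = 0) ∧ T X = v

variable {b T}

theorem IsLift.unique {v : W} {X X' : V} (h : IsLift b T v X) (h' : IsLift b T v X') : X = X' := by
  by_contra h0
  have := basisForm_self_pos b (sub_ne_zero.2 h0)
  rw [basisForm_sub_left, h.1, h'.1] at this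
  · simp at this
  · simp [h.2, h'.2]
  · simp [h.2, h'.2]

theorem IsLift.add {v v' : W} {X X' : V} (h : IsLift b T v X) (h' : IsLift b T v' X') :
    IsLift b T (v + v') (X + X') :=
  ⟨fun Y hY => by rw [basisForm_add_left, h.1 Y hY, h'.1 Y hY, add_zero], by simp [h.2, h'.2]⟩

theorem IsLift.smul {v : W} {X : V} (c : ℂ) (h : IsLift b T v X) : IsLift b T (c • v) (c • X) :=
  ⟨fun Y hY => by rw [basisForm_smul_left, h.1 Y hY, mul_zero], by simp [h.2]⟩

/-- Vectors that span `ℂⁿ` have an invertible Gram tensor. -/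
theorem isUnit_det_vecGram {s : ι → Fin n → ℂ}
    (hs : ∀ u : Fin n → ℂ, ∃ x : ι → ℂ, ∀ k, ∑ a, x a * s a k = u k) :
    IsUnit (vecGram s).det := by
  rw [isUnit_iff_ne_zero]
  intro h0
  obtain ⟨w, hw0, hw⟩ := Matrix.exists_mulVec_eq_zero_iff.2 h0
  -- A null vector `w` of the Gram tensor is orthogonal to every `sₐ`, hence to their span, which
  -- contains `w`.
  have h1 : ∑ a, (‖∑ j, conj (s a j) * w j‖ : ℂ) ^ 2 = 0 := by
    calc _ = ∑ a, ∑ i, ∑ j, conj (w i) * (s a i * conj (s a j)) * w j := by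
          refine Finset.sum_congr rfl fun a _ => ?_
          rw [← Complex.conj_mul', map_sum, Finset.sum_mul_sum]
          refine Finset.sum_congr rfl fun i _ => Finset.sum_congr rfl fun j _ => ?_
          simp only [map_mul, RCLike.conj_conj]
          ring
      _ = ∑ i, conj (w i) * (vecGram s).mulVec w i := by
          rw [Finset.sum_comm]
          refine Finset.sum_congr rfl fun i _ => ?_
          rw [Finset.sum_comm]
          simp only [Matrix.mulVec, dotProduct, vecGram, Matrix.of_apply, Finset.sum_mul,
            Finset.mul_sum]
          exact Finset.sum_congr rfl fun j _ => Finset.sum_congr rfl fun a _ => by ring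
      _ = 0 := by simp [hw]
  have h2 : ∑ a, ‖∑ j, conj (s a j) * w j‖ ^ 2 = 0 := by exact_mod_cast h1
  have h3 : ∀ a, ∑ j, conj (s a j) * w j = 0 := fun a => by
    have := (Finset.sum_eq_zero_iff_of_nonneg fun a _ => by positivity).1 h2 a (Finset.mem_univ a)
    simpa using this
  obtain ⟨x, hx⟩ := hs w
  have h4 : ∑ k, conj (w k) * w k = 0 := by
    calc _ = ∑ a, conj (x a) * ∑ j, conj (s a j) * w j := by
          rw [show ∑ k, conj (w k) * w k = ∑ k, conj (∑ a, x a * s a k) * w k by simp only [hx]]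
          simp only [map_sum, map_mul, Finset.mul_sum, Finset.sum_mul]
          rw [Finset.sum_comm]
          exact Finset.sum_congr rfl fun j _ => Finset.sum_congr rfl fun a _ => by ring
      _ = 0 := by simp [h3]
  refine hw0 (funext fun k => ?_)
  simp only [Complex.conj_mul'] at h4
  have h5 : ∑ k, ‖w k‖ ^ 2 = 0 := by exact_mod_cast h4
  have := (Finset.sum_eq_zero_iff_of_nonneg fun a _ => by positivity).1 h5 k (Finset.mem_univ k)
  simpa using this

variable (b) in
/-- The horizontal lift of the vector with coordinates `u`, when `T` sends the `a`-th basis vector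
to the vector with coordinates `s a`. -/
def coordLift (s : ι → Fin n → ℂ) (u : Fin n → ℂ) : V :=
  ∑ a, (∑ k, conj (s a k) * ((vecGram s)⁻¹).mulVec u k) • b a

theorem repr_coordLift (s : ι → Fin n → ℂ) (u : Fin n → ℂ) (a : ι) :
    b.repr (coordLift b s u) a = ∑ k, conj (s a k) * ((vecGram s)⁻¹).mulVec u k := by
  rw [coordLift, b.repr_sum_self]

theorem sum_vecGram_mul {s : ι → Fin n → ℂ} (hs : IsUnit (vecGram s).det) (u : Fin n → ℂ)
    (i : Fin n) : ∑ a, (∑ k, conj (s a k) * ((vecGram s)⁻¹).mulVec u k) * s a i = u i := by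
  have h1 : (vecGram s).mulVec (((vecGram s)⁻¹).mulVec u) = u := by
    rw [Matrix.mulVec_mulVec, Matrix.mul_nonsing_inv _ hs, Matrix.one_mulVec]
  conv_rhs => rw [← h1, Matrix.mulVec, dotProduct]
  simp only [vecGram, Matrix.of_apply, Finset.sum_mul]
  rw [Finset.sum_comm]
  exact Finset.sum_congr rfl fun k _ => Finset.sum_congr rfl fun a _ => by ring

/-- In coordinates the lift is `T* (T T*)⁻¹ u`, with the Gram tensor as `T T*`: it lies in the image
of `T*`, which is orthogonal to `ker T`. -/
theorem isLift_coordLift {s : ι → Fin n → ℂ} (hs : IsUnit (vecGram s).det)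
    (φ : W →ₗ[ℂ] Fin n → ℂ) (hφ : Function.Injective φ) (h : ∀ a k, φ (T (b a)) k = s a k)
    {v : W} {u : Fin n → ℂ} (hv : φ v = u) : IsLift b T v (coordLift b s u) := by
  have hT : ∀ Y k, φ (T Y) k = ∑ a, b.repr Y a * s a k := fun Y k => by
    conv_lhs => rw [← b.sum_repr Y]
    simp only [map_sum, map_smul, Finset.sum_apply, Pi.smul_apply, h, smul_eq_mul]
  refine ⟨fun Y hY => ?_, hφ ?_⟩
  · have h0 : ∀ k, ∑ a, b.repr Y a * s a k = 0 := fun k => by rw [← hT, hY]; simp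
    simp only [basisForm, repr_coordLift]
    calc _ = ∑ k, ((vecGram s)⁻¹).mulVec u k * conj (∑ a, b.repr Y a * s a k) := by
          simp only [map_sum, map_mul, Finset.mul_sum, Finset.sum_mul]
          rw [Finset.sum_comm]
          exact Finset.sum_congr rfl fun k _ => Finset.sum_congr rfl fun a _ => by ring
      _ = 0 := by simp [h0]
  · ext k
    rw [hv, hT]
    simp only [repr_coordLift]
    exact sum_vecGram_mul hs u k

/-- The product of `T* (T T*)⁻¹ u` and `T* (T T*)⁻¹ u'` is `⟨(T T*)⁻¹ u, u'⟩`; the transpose stems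
from linearity in the first argument. -/
theorem basisForm_coordLift {s : ι → Fin n → ℂ} (hs : IsUnit (vecGram s).det) (i j : Fin n) :
    basisForm b (coordLift b s (Pi.single i 1)) (coordLift b s (Pi.single j 1))
      = ((vecGram s)⁻¹).transpose i j := by
  have hc : conj ((vecGram s)⁻¹ i j) = (vecGram s)⁻¹ j i := by
    have : ((vecGram s)⁻¹).conjTranspose = (vecGram s)⁻¹ := by
      rw [Matrix.conjTranspose_nonsing_inv, conjTranspose_vecGram]
    conv_rhs => rw [← this]
    rfl
  simp only [basisForm, repr_coordLift]
  calc _ = ∑ k, (∑ a, (∑ l, conj (s a l) * ((vecGram s)⁻¹).mulVec (Pi.single i 1) l) * s a k)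
        * conj (((vecGram s)⁻¹).mulVec (Pi.single j 1) k) := by
        simp only [map_sum, map_mul, RCLike.conj_conj, Finset.mul_sum]
        rw [Finset.sum_comm]
        refine Finset.sum_congr rfl fun k _ => ?_
        rw [Finset.sum_mul]
        exact Finset.sum_congr rfl fun a _ => by ring
    _ = _ := by
        simp only [sum_vecGram_mul hs]
        simp [Pi.single_apply, hc]

end Lift

/-! ### The complexified orthonormal basis -/

section Kappa

variable {𝔨 : Type*} [LieRing 𝔨] [LieAlgebra ℝ 𝔨] {ι : Type*}
  {𝔤 : Type*} [LieRing 𝔤] [LieAlgebra ℂ 𝔤]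

/-- The complex basis of `𝔤 = ℂ ⊗ 𝔨` induced by a real basis of `𝔨`. -/
def complexBasis (e : Module.Basis ι ℝ 𝔨) (Φ : (ℂ ⊗[ℝ] 𝔨) ≃ₗ⁅ℂ⁆ 𝔤) : Module.Basis ι ℂ 𝔤 :=
  (e.baseChange ℂ).map Φ.toLinearEquiv

theorem complexBasis_apply (e : Module.Basis ι ℝ 𝔨) (Φ : (ℂ ⊗[ℝ] 𝔨) ≃ₗ⁅ℂ⁆ 𝔤) (a : ι) :
    complexBasis e Φ a = Φ (1 ⊗ₜ e a) := by
  simp [complexBasis]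

theorem kappaInv_eq_basisForm [Fintype ι] [DecidableEq ι] {B : LinearMap.BilinForm ℝ 𝔨} (e : Module.Basis ι ℝ 𝔨)
    (he : ∀ a b, B (e a) (e b) = if a = b then 1 else 0) (Φ : (ℂ ⊗[ℝ] 𝔨) ≃ₗ⁅ℂ⁆ 𝔤) :
    kappaInv B Φ = basisForm (complexBasis e Φ) := by
  ext X Y
  have h1 : ∀ X, Φ.symm X = ∑ a, (complexBasis e Φ).repr X a ⊗ₜ[ℝ] e a := fun X => by
    conv_lhs => rw [← (complexBasis e Φ).sum_repr X]
    rw [map_sum]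
    refine Finset.sum_congr rfl fun a _ => ?_
    rw [map_smul, complexBasis_apply, LieEquiv.symm_apply_apply, TensorProduct.smul_tmul', smul_eq_mul,
      mul_one]
  rw [kappaInv, h1, h1]
  have h2 : ∀ (x y : ι → ℂ), sesqExtension B (∑ a, x a ⊗ₜ[ℝ] e a) (∑ a, y a ⊗ₜ[ℝ] e a)
      = ∑ a, ∑ b, sesqExtension B (x a ⊗ₜ[ℝ] e a) (y b ⊗ₜ[ℝ] e b) := fun x y => by
    simp only [sesqExtension, map_sum, LinearMap.sum_apply]
    exact Finset.sum_comm
  rw [h2]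
  simp [sesqExtension_tmul, he, basisForm, apply_ite Complex.ofReal]

/-- Complexification keeps the structure constants, and in particular keeps them real, as the
contraction identity requires. -/
theorem lie_complexBasis [Fintype ι] (e : Module.Basis ι ℝ 𝔨) (Φ : (ℂ ⊗[ℝ] 𝔨) ≃ₗ⁅ℂ⁆ 𝔤) (a b : ι) :
    ⁅complexBasis e Φ a, complexBasis e Φ b⁆
      = ∑ d, (e.repr ⁅e a, e b⁆ d : ℂ) • complexBasis e Φ d := by
  simp only [complexBasis_apply, ← LieEquiv.map_lie, LieAlgebra.ExtendScalars.bracket_tmul, mul_one]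
  conv_lhs => rw [← e.sum_repr ⁅e a, e b⁆]
  rw [TensorProduct.tmul_sum, map_sum]
  refine Finset.sum_congr rfl fun d _ => ?_
  rw [← TensorProduct.smul_tmul, ← map_smul Φ, TensorProduct.smul_tmul']
  simp

end Kappa

/-! ### Brackets of vector fields in vector spaces -/

section VectorCalculus

open VectorField Filter Topology

variable {E F : Type*} [NormedAddCommGroup E] [NormedSpace ℂ E] [NormedAddCommGroup F]
  [NormedSpace ℂ F]

/-- Brackets of `f`-related vector fields are `f`-related. -/
theorem fderiv_lieBracket_of_related {f : E → F} {p : E} (hf : ContDiffAt ℂ ω f p)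
    {V W : E → E} {V' W' : F → F} (hV : DifferentiableAt ℂ V p) (hW : DifferentiableAt ℂ W p)
    (hV' : DifferentiableAt ℂ V' (f p)) (hW' : DifferentiableAt ℂ W' (f p))
    (hVV : ∀ᶠ a in 𝓝 p, fderiv ℂ f a (V a) = V' (f a))
    (hWW : ∀ᶠ a in 𝓝 p, fderiv ℂ f a (W a) = W' (f a)) :
    fderiv ℂ f p (lieBracket ℂ V W p) = lieBracket ℂ V' W' (f p) := by
  have hfd : DifferentiableAt ℂ f p := hf.differentiableAt (by simp)
  have hdf : DifferentiableAt ℂ (fderiv ℂ f) p :=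
    (hf.fderiv_right (m := ω) (by simp)).differentiableAt (by simp)
  -- The derivative of `Df(V) = V' ∘ f`. In the bracket the second derivatives of `f` cancel by
  -- symmetry.
  have key : ∀ {V : E → E} {V' : F → F}, DifferentiableAt ℂ V p → DifferentiableAt ℂ V' (f p) →
      (∀ᶠ a in 𝓝 p, fderiv ℂ f a (V a) = V' (f a)) → ∀ ξ, fderiv ℂ V' (f p) (fderiv ℂ f p ξ)
        = fderiv ℂ (fderiv ℂ f) p ξ (V p) + fderiv ℂ f p (fderiv ℂ V p ξ) := by
    intro V V' hV hV' h ξ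
    have h1 := Filter.EventuallyEq.fderiv_eq (𝕜 := ℂ) h
    rw [fderiv_clm_apply hdf hV, fderiv_fun_comp p hV' hfd] at h1
    have h2 := DFunLike.congr_fun h1 ξ
    simp only [add_apply, ContinuousLinearMap.comp_apply, ContinuousLinearMap.flip_apply] at h2
    rw [← h2, add_comm]
  have hsymm := hf.isSymmSndFDerivAt (by simp) (V p) (W p)
  rw [lieBracket, lieBracket, ← hVV.self_of_nhds, ← hWW.self_of_nhds, key hV hV' hVV,
    key hW hW' hWW, hsymm, map_sub]
  abel

/-- For a local group law, the brackets of right invariant and left invariant vector fields differ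
by a sign. -/
theorem lieBracket_right_invariant {μ : E × E → E} {p : E} (hμ : ContDiffAt ℂ ω μ (p, p))
    (h1 : ∀ᶠ a in 𝓝 p, μ (a, p) = a) (h2 : ∀ᶠ b in 𝓝 p, μ (p, b) = b) (ξ η : E) :
    lieBracket ℂ (fun b => fderiv ℂ μ (p, b) (ξ, 0)) (fun b => fderiv ℂ μ (p, b) (η, 0)) p
      = -lieBracket ℂ (fun a => fderiv ℂ μ (a, p) (0, ξ)) (fun a => fderiv ℂ μ (a, p) (0, η)) p := by
  have hμd : DifferentiableAt ℂ μ (p, p) := hμ.differentiableAt (by simp)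
  have hdμ : DifferentiableAt ℂ (fderiv ℂ μ) (p, p) :=
    (hμ.fderiv_right (m := ω) (by simp)).differentiableAt (by simp)
  have hl : HasFDerivAt (fun a : E => (a, p)) (ContinuousLinearMap.inl ℂ E E) p :=
    hasFDerivAt_prodMk_left p p
  have hr : HasFDerivAt (fun b : E => (p, b)) (ContinuousLinearMap.inr ℂ E E) p :=
    hasFDerivAt_prodMk_right p p
  have hL : ∀ ξ, fderiv ℂ μ (p, p) (0, ξ) = ξ := fun ξ => by
    have h3 := (HasFDerivAt.comp (g := μ) (f := fun b : E => (p, b)) p hμd.hasFDerivAt hr).congr_of_eventuallyEq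
      (f₁ := id) (by filter_upwards [h2] with b hb using hb.symm)
    have h4 := DFunLike.congr_fun (h3.unique (hasFDerivAt_id p)) ξ
    simpa using h4
  have hR : ∀ ξ, fderiv ℂ μ (p, p) (ξ, 0) = ξ := fun ξ => by
    have h3 := (HasFDerivAt.comp (g := μ) (f := fun a : E => (a, p)) p hμd.hasFDerivAt hl).congr_of_eventuallyEq
      (f₁ := id) (by filter_upwards [h1] with b hb using hb.symm)
    have h4 := DFunLike.congr_fun (h3.unique (hasFDerivAt_id p)) ξ
    simpa using h4
  -- Derivatives of left and right invariant fields are mixed second derivatives of `μ` with the two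
  -- slots exchanged, so symmetry swaps the two terms of the bracket.
  have hdL : ∀ v ζ, fderiv ℂ (fun a => fderiv ℂ μ (a, p) v) p ζ
      = fderiv ℂ (fderiv ℂ μ) (p, p) (ζ, 0) v := fun v ζ => by
    have h3 := (HasFDerivAt.comp (g := fderiv ℂ μ) (f := fun a : E => (a, p)) p hdμ.hasFDerivAt hl).clm_apply (hasFDerivAt_const v p)
    have h4 := DFunLike.congr_fun h3.fderiv ζ
    simpa using h4
  have hdR : ∀ v ζ, fderiv ℂ (fun b => fderiv ℂ μ (p, b) v) p ζ
      = fderiv ℂ (fderiv ℂ μ) (p, p) (0, ζ) v := fun v ζ => by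
    have h3 := (HasFDerivAt.comp (g := fderiv ℂ μ) (f := fun b : E => (p, b)) p hdμ.hasFDerivAt hr).clm_apply (hasFDerivAt_const v p)
    have h4 := DFunLike.congr_fun h3.fderiv ζ
    simpa using h4
  have hsymm := fun v w => hμ.isSymmSndFDerivAt (by simp) v w
  rw [lieBracket, lieBracket]
  simp only [hL, hR, hdL, hdR]
  rw [hsymm (ξ, 0) (0, η), hsymm (η, 0) (0, ξ)]
  abel

end VectorCalculus

/-! ### Differentials of holomorphic charts -/

section Charts

variable {n : ℕ} {N : Type*} [TopologicalSpace N] [ChartedSpace (Cn n) N]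
  {e : OpenPartialHomeomorph N (Cn n)}
  (he : e ∈ IsManifold.maximalAtlas 𝓘(ℂ, Cn n) ω N)

include he

theorem mdifferentiable_of_mem_maximalAtlas : e.MDifferentiable 𝓘(ℂ, Cn n) 𝓘(ℂ, Cn n) :=
  ⟨(contMDiffOn_of_mem_maximalAtlas he).mdifferentiableOn (by simp),
    (contMDiffOn_symm_of_mem_maximalAtlas he).mdifferentiableOn (by simp)⟩

theorem mfderiv_chart_symm_apply {z : Cn n} (hz : z ∈ e.target) (u : Cn n) :
    mfderiv 𝓘(ℂ, Cn n) 𝓘(ℂ, Cn n) e (e.symm z) (mfderiv 𝓘(ℂ, Cn n) 𝓘(ℂ, Cn n) e.symm z u) = u :=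
  DFunLike.congr_fun ((mdifferentiable_of_mem_maximalAtlas he).comp_symm_deriv hz) u

theorem mfderiv_chart_injective {x : N} (hx : x ∈ e.source) :
    Function.Injective (mfderiv 𝓘(ℂ, Cn n) 𝓘(ℂ, Cn n) e x) :=
  (mdifferentiable_of_mem_maximalAtlas he).mfderiv_injective hx

theorem mfderiv_symm_chart_comp {z : Cn n} (hz : z ∈ e.target) :
    (mfderiv 𝓘(ℂ, Cn n) 𝓘(ℂ, Cn n) e.symm z).comp
      (mfderiv 𝓘(ℂ, Cn n) 𝓘(ℂ, Cn n) e (e.symm z)) = ContinuousLinearMap.id ℂ _ := by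
  ext u
  refine mfderiv_chart_injective he (e.map_target hz) ?_
  exact mfderiv_chart_symm_apply he hz _

end Charts

/-! ### The group action in charts -/

section Fundamental

open VectorField Filter Topology

variable {m n : ℕ} {G : Type*} [TopologicalSpace G] [ChartedSpace (Cn m) G] [Group G]
  [LieGroup 𝓘(ℂ, Cn m) ω G]
  {N : Type*} [TopologicalSpace N] [ChartedSpace (Cn n) N]
  {e : OpenPartialHomeomorph N (Cn n)}

variable (m G) in
/-- The chart of `G` at `1`. -/
abbrev oneChart : OpenPartialHomeomorph G (Cn m) := chartAt (Cn m) (1 : G)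

variable (m G) in
/-- The coordinates of `1`. -/
abbrev oneCoord : Cn m := oneChart m G (1 : G)

/-- The coordinates of a vector in the Lie algebra. -/
def lieCoord (X : GroupLieAlgebra 𝓘(ℂ, Cn m) G) : Cn m :=
  mfderiv 𝓘(ℂ, Cn m) 𝓘(ℂ, Cn m) (oneChart m G) (1 : G) X

variable (m G) in
theorem oneChart_mem : oneChart m G ∈ IsManifold.maximalAtlas 𝓘(ℂ, Cn m) ω G :=
  IsManifold.chart_mem_maximalAtlas 1

/-- The differential at `1` of a map from `G` in charts. -/
theorem mfderiv_chart_apply (he : e ∈ IsManifold.maximalAtlas 𝓘(ℂ, Cn n) ω N) {o : G → N}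
    (ho : MDifferentiableAt 𝓘(ℂ, Cn m) 𝓘(ℂ, Cn n) o 1) {x : N} (hx : o 1 = x) (hxe : x ∈ e.source)
    (X : GroupLieAlgebra 𝓘(ℂ, Cn m) G) :
    mfderiv 𝓘(ℂ, Cn n) 𝓘(ℂ, Cn n) e x (mfderiv 𝓘(ℂ, Cn m) 𝓘(ℂ, Cn n) o (1 : G) X)
      = fderiv ℂ (fun b => e (o ((oneChart m G).symm b))) (oneCoord m G) (lieCoord X) := by
  subst hx
  set K : Cn m → Cn n := fun b => e (o ((oneChart m G).symm b)) with hK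
  have h1s : (1 : G) ∈ (oneChart m G).source := mem_chart_source _ _
  have hmd := mdifferentiable_of_mem_maximalAtlas he
  have hmφ := mdifferentiable_of_mem_maximalAtlas (oneChart_mem m G)
  have heo : MDifferentiableAt 𝓘(ℂ, Cn n) 𝓘(ℂ, Cn n) e (o 1) := hmd.mdifferentiableAt hxe
  have hφ1 : (oneChart m G).symm (oneCoord m G) = 1 := (oneChart m G).left_inv h1s
  have hKd : MDifferentiableAt 𝓘(ℂ, Cn m) 𝓘(ℂ, Cn n) K (oneCoord m G) := by
    refine MDifferentiableAt.comp (I' := 𝓘(ℂ, Cn m)) (g := fun g => e (o g)) _ ?_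
      (hmφ.symm.mdifferentiableAt ((oneChart m G).map_source h1s))
    rw [hφ1]
    exact MDifferentiableAt.comp (I' := 𝓘(ℂ, Cn n)) _ heo ho
  have hE : (fun g => e (o g)) =ᶠ[𝓝 (1 : G)] fun g => K (oneChart m G g) := by
    filter_upwards [(oneChart m G).open_source.mem_nhds h1s] with g hg
    rw [hK]
    simp only [(oneChart m G).left_inv hg]
  have h1 : HasMFDerivAt 𝓘(ℂ, Cn m) 𝓘(ℂ, Cn n) (fun g => e (o g)) (1 : G)
      ((mfderiv 𝓘(ℂ, Cn n) 𝓘(ℂ, Cn n) e (o 1)).comp (mfderiv 𝓘(ℂ, Cn m) 𝓘(ℂ, Cn n) o (1 : G))) :=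
    HasMFDerivAt.comp (1 : G) heo.hasMFDerivAt ho.hasMFDerivAt
  have h2 : HasMFDerivAt 𝓘(ℂ, Cn m) 𝓘(ℂ, Cn n) (fun g => K (oneChart m G g)) (1 : G)
      ((mfderiv 𝓘(ℂ, Cn m) 𝓘(ℂ, Cn n) K (oneCoord m G)).comp
        (mfderiv 𝓘(ℂ, Cn m) 𝓘(ℂ, Cn m) (oneChart m G) (1 : G))) :=
    HasMFDerivAt.comp (I' := 𝓘(ℂ, Cn m)) (g := K) (f := oneChart m G) (1 : G) hKd.hasMFDerivAt (hmφ.mdifferentiableAt h1s).hasMFDerivAt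
  have h3 := hasMFDerivAt_unique h1 (h2.congr_of_eventuallyEq hE)
  rw [← mfderiv_eq_fderiv]
  exact DFunLike.congr_fun h3 X

section Action

variable [MulAction G N] [ContMDiffSMul 𝓘(ℂ, Cn m) 𝓘(ℂ, Cn n) ω G N]

variable (m G e) in
/-- The action of `G` on `N` in charts, near `1`. -/
def actCoord (w : Cn m × Cn n) : Cn n := e ((oneChart m G).symm w.1 • e.symm w.2)

theorem contMDiffAt_chart_smul (he : e ∈ IsManifold.maximalAtlas 𝓘(ℂ, Cn n) ω N) {a : Cn m}
    {z : Cn n} (ha : a ∈ (oneChart m G).target) (hz : z ∈ e.target) :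
    ContMDiffAt 𝓘(ℂ, Cn m × Cn n) 𝓘(ℂ, Cn n) ω
      (fun w : Cn m × Cn n => (oneChart m G).symm w.1 • e.symm w.2) (a, z) := by
  refine ContMDiffAt.smul (I := 𝓘(ℂ, Cn m)) ?_ ?_
  · exact ContMDiffAt.comp (I' := 𝓘(ℂ, Cn m)) (a, z)
      (contMDiffAt_symm_of_mem_maximalAtlas (oneChart_mem m G) ha) contDiffAt_fst.contMDiffAt
  · exact ContMDiffAt.comp (I' := 𝓘(ℂ, Cn n)) (a, z)
      (contMDiffAt_symm_of_mem_maximalAtlas he hz) contDiffAt_snd.contMDiffAt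

theorem contDiffAt_actCoord (he : e ∈ IsManifold.maximalAtlas 𝓘(ℂ, Cn n) ω N) {a : Cn m}
    {z : Cn n} (ha : a ∈ (oneChart m G).target) (hz : z ∈ e.target)
    (haz : (oneChart m G).symm a • e.symm z ∈ e.source) :
    ContDiffAt ℂ ω (actCoord m G e) (a, z) :=
  contMDiffAt_iff_contDiffAt.1 (ContMDiffAt.comp (I' := 𝓘(ℂ, Cn n)) (a, z)
    (contMDiffAt_of_mem_maximalAtlas he haz) (contMDiffAt_chart_smul he ha hz))

end Action

end Fundamental

/-! ### Generated vector fields and their brackets -/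

section Fundamental

open VectorField Filter Topology

theorem mlieBracket_eq_lieBracket {E : Type*} [NormedAddCommGroup E] [NormedSpace ℂ E]
    (V W : E → E) (x : E) : mlieBracket 𝓘(ℂ, E) V W x = lieBracket ℂ V W x := by
  rw [← lieBracketWithin_univ]
  exact congr_fun (mlieBracketWithin_eq_lieBracketWithin (s := Set.univ)) x

variable {m n : ℕ} {G : Type*} [TopologicalSpace G] [ChartedSpace (Cn m) G] [Group G]
  {N : Type*} [TopologicalSpace N] [MulAction G N] {e : OpenPartialHomeomorph N (Cn n)}

theorem oneCoord_mem : oneCoord m G ∈ (oneChart m G).target :=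
  (oneChart m G).map_source (mem_chart_source _ _)

theorem oneChart_symm_oneCoord : (oneChart m G).symm (oneCoord m G) = 1 :=
  (oneChart m G).left_inv (mem_chart_source _ _)

theorem smul_chart_symm_mem {z : Cn n} (hz : z ∈ e.target) :
    (oneChart m G).symm (oneCoord m G) • e.symm z ∈ e.source := by
  rw [oneChart_symm_oneCoord, one_smul]
  exact e.map_target hz

theorem actCoord_oneCoord {z : Cn n} (hz : z ∈ e.target) :
    actCoord m G e (oneCoord m G, z) = z := by
  rw [actCoord, oneChart_symm_oneCoord, one_smul, e.right_inv hz]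

/-- For `N = G` acting on itself, `actCoord` is the group law in the chart at `1`. -/
theorem actCoord_mul_oneCoord {a : Cn m} (ha : a ∈ (oneChart m G).target) :
    actCoord m G (oneChart m G) (a, oneCoord m G) = a := by
  rw [actCoord, oneChart_symm_oneCoord, smul_eq_mul, mul_one, (oneChart m G).right_inv ha]

variable [ChartedSpace (Cn n) N]

variable (e) in
/-- The vector field on `N` generated by `X`, in a chart. -/
def fundField (X : GroupLieAlgebra 𝓘(ℂ, Cn m) G) (z : Cn n) : Cn n :=
  mfderiv 𝓘(ℂ, Cn n) 𝓘(ℂ, Cn n) e (e.symm z) (ev G (e.symm z) X)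

variable [LieGroup 𝓘(ℂ, Cn m) ω G] [ContMDiffSMul 𝓘(ℂ, Cn m) 𝓘(ℂ, Cn n) ω G N]
  (he : e ∈ IsManifold.maximalAtlas 𝓘(ℂ, Cn n) ω N)

include he

theorem eventually_smul_mem {a : Cn m} {z : Cn n} (ha : a ∈ (oneChart m G).target)
    (hz : z ∈ e.target) (haz : (oneChart m G).symm a • e.symm z ∈ e.source) :
    ∀ᶠ w : Cn m × Cn n in 𝓝 (a, z), (oneChart m G).symm w.1 • e.symm w.2 ∈ e.source :=
  (contMDiffAt_chart_smul he ha hz).continuousAt (e.open_source.mem_nhds haz)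

theorem differentiableAt_actCoord {a : Cn m} {z : Cn n} (ha : a ∈ (oneChart m G).target)
    (hz : z ∈ e.target) (haz : (oneChart m G).symm a • e.symm z ∈ e.source) :
    DifferentiableAt ℂ (actCoord m G e) (a, z) :=
  (contDiffAt_actCoord he ha hz haz).differentiableAt (by simp)

theorem hasFDerivAt_actCoord_left {a : Cn m} {z : Cn n} (ha : a ∈ (oneChart m G).target)
    (hz : z ∈ e.target) (haz : (oneChart m G).symm a • e.symm z ∈ e.source) :
    HasFDerivAt (fun b => actCoord m G e (b, z))
      ((fderiv ℂ (actCoord m G e) (a, z)).comp (ContinuousLinearMap.inl ℂ (Cn m) (Cn n))) a :=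
  HasFDerivAt.comp (g := actCoord m G e) (f := fun b : Cn m => (b, z)) a
    (differentiableAt_actCoord he ha hz haz).hasFDerivAt (hasFDerivAt_prodMk_left a z)

theorem fundField_eq (X : GroupLieAlgebra 𝓘(ℂ, Cn m) G) {z : Cn n} (hz : z ∈ e.target) :
    fundField e X z = fderiv ℂ (actCoord m G e) (oneCoord m G, z) (lieCoord X, 0) := by
  have ho : MDifferentiableAt 𝓘(ℂ, Cn m) 𝓘(ℂ, Cn n) (fun a : G => a • e.symm z) 1 := by
    have := ContMDiffAt.smul (I := 𝓘(ℂ, Cn m)) (I' := 𝓘(ℂ, Cn n)) (n := ω) (x := (1 : G))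
      (f := fun a : G => a) (g := fun _ => e.symm z) contMDiffAt_id contMDiffAt_const
    exact ContMDiffAt.mdifferentiableAt this (by simp)
  refine (mfderiv_chart_apply he ho (one_smul _ _) (e.map_target hz) X).trans ?_
  have h1 := (hasFDerivAt_actCoord_left he oneCoord_mem hz
    (smul_chart_symm_mem (m := m) (G := G) hz)).fderiv
  exact DFunLike.congr_fun h1 (lieCoord X)

theorem contDiffAt_fundField (X : GroupLieAlgebra 𝓘(ℂ, Cn m) G) {z : Cn n} (hz : z ∈ e.target) :
    ContDiffAt ℂ ω (fundField e X) z := by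
  have h1 : ContDiffAt ℂ ω (fderiv ℂ (actCoord m G e)) (oneCoord m G, z) :=
    (contDiffAt_actCoord he oneCoord_mem hz (smul_chart_symm_mem hz)).fderiv_right (by simp)
  have h2 : ContDiffAt ℂ ω (fun z => fderiv ℂ (actCoord m G e) (oneCoord m G, z)) z :=
    ContDiffAt.comp (g := fderiv ℂ (actCoord m G e)) (f := fun z : Cn n => (oneCoord m G, z)) z h1
      (contDiffAt_const.prodMk contDiffAt_id)
  refine (h2.clm_apply (contDiffAt_const (c := ((lieCoord X, 0) : Cn m × Cn n)))
    ).congr_of_eventuallyEq ?_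
  filter_upwards [e.open_target.mem_nhds hz] with w hw using fundField_eq he X hw

/-- The orbit map relates right invariant vector fields on `G` to the generated vector fields. -/
theorem eventually_fderiv_orbit (X : GroupLieAlgebra 𝓘(ℂ, Cn m) G) {z : Cn n} (hz : z ∈ e.target) :
    ∀ᶠ b in 𝓝 (oneCoord m G), fderiv ℂ (fun a => actCoord m G e (a, z)) b
        (fderiv ℂ (actCoord m G (oneChart m G)) (oneCoord m G, b) (lieCoord X, 0))
      = fundField e X (actCoord m G e (b, z)) := by
  have hp : oneCoord m G ∈ (oneChart m G).target := oneCoord_mem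
  have hT : ∀ᶠ b in 𝓝 (oneCoord m G), b ∈ (oneChart m G).target :=
    (oneChart m G).open_target.mem_nhds hp
  have hS : ∀ᶠ b in 𝓝 (oneCoord m G), (oneChart m G).symm b • e.symm z ∈ e.source :=
    ((Continuous.prodMk_left z).tendsto (oneCoord m G)).eventually
      (eventually_smul_mem he hp hz (smul_chart_symm_mem hz))
  have hA : ∀ᶠ w : Cn m × Cn m in 𝓝 (oneCoord m G, oneCoord m G),
      (oneChart m G).symm w.1 • (oneChart m G).symm w.2 ∈ (oneChart m G).source :=
    eventually_smul_mem (oneChart_mem m G) hp hp (smul_chart_symm_mem hp)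
  have hA' := ((continuous_swap.tendsto (oneCoord m G, oneCoord m G)).eventually hA).curry_nhds
  filter_upwards [hT, hS, hA'] with b hbT hbS hbA
  have hμ := hasFDerivAt_actCoord_left (oneChart_mem m G) hp hbT (smul_chart_symm_mem hbT)
  have hb : actCoord m G (oneChart m G) (oneCoord m G, b) = b := actCoord_oneCoord hbT
  have hf := hasFDerivAt_actCoord_left he hbT hz hbS
  have hfb : actCoord m G e (b, z) ∈ e.target := e.map_source hbS
  have hF := hasFDerivAt_actCoord_left he hp hfb (smul_chart_symm_mem hfb)
  rw [fundField_eq he X hfb]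
  -- The relation is the derivative of `(a * b) • x = a • (b • x)` with respect to `a` at `1`.
  have h1 : HasFDerivAt (fun a => actCoord m G e (actCoord m G (oneChart m G) (a, b), z))
      ((fderiv ℂ (fun a => actCoord m G e (a, z)) b).comp _) (oneCoord m G) :=
    HasFDerivAt.comp (g := fun a => actCoord m G e (a, z))
      (f := fun a => actCoord m G (oneChart m G) (a, b)) (oneCoord m G)
      (by rw [hb]; exact hf.differentiableAt.hasFDerivAt) hμ
  have h2 : (fun a => actCoord m G e (a, actCoord m G e (b, z))) =ᶠ[𝓝 (oneCoord m G)]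
      fun a => actCoord m G e (actCoord m G (oneChart m G) (a, b), z) := by
    filter_upwards [hbA] with a ha
    have ha' : (oneChart m G).symm a • (oneChart m G).symm b ∈ (oneChart m G).source := ha
    simp only [actCoord]
    rw [e.left_inv hbS, (oneChart m G).left_inv ha', smul_eq_mul, mul_smul]
  have h3 := (h1.congr_of_eventuallyEq h2).unique hF
  exact DFunLike.congr_fun h3 (lieCoord X)

omit he in
/-- The bracket of the Lie algebra of `G` in the chart at `1`. -/
theorem lieCoord_lie (X Y : GroupLieAlgebra 𝓘(ℂ, Cn m) G) :
    lieCoord ⁅X, Y⁆ = lieBracket ℂ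
      (fun a => fderiv ℂ (actCoord m G (oneChart m G)) (a, oneCoord m G) (0, lieCoord X))
      (fun a => fderiv ℂ (actCoord m G (oneChart m G)) (a, oneCoord m G) (0, lieCoord Y))
      (oneCoord m G) := by
  have hφ := oneChart_mem m G
  have hmul : ∀ (X : GroupLieAlgebra 𝓘(ℂ, Cn m) G) (a : Cn m), a ∈ (oneChart m G).target →
      mpullback 𝓘(ℂ, Cn m) 𝓘(ℂ, Cn m) (oneChart m G).symm (mulInvariantVectorField X) a
        = fderiv ℂ (actCoord m G (oneChart m G)) (a, oneCoord m G) (0, lieCoord X) := by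
    intro X a ha
    have h1 : (mfderiv 𝓘(ℂ, Cn m) 𝓘(ℂ, Cn m) (oneChart m G).symm a).inverse
        = mfderiv 𝓘(ℂ, Cn m) 𝓘(ℂ, Cn m) (oneChart m G) ((oneChart m G).symm a) :=
      ContinuousLinearMap.inverse_eq (mfderiv_symm_chart_comp hφ ha)
        ((mdifferentiable_of_mem_maximalAtlas hφ).comp_symm_deriv ha)
    have ho : MDifferentiableAt 𝓘(ℂ, Cn m) 𝓘(ℂ, Cn m)
        (fun g : G => (oneChart m G).symm a * g) 1 :=
      (contMDiff_mul_left (n := ω)).contMDiffAt.mdifferentiableAt (by simp)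
    have ha1 : (oneChart m G).symm a • (oneChart m G).symm (oneCoord m G)
        ∈ (oneChart m G).source := by
      rw [oneChart_symm_oneCoord, smul_eq_mul, mul_one]
      exact (oneChart m G).map_target ha
    have h2 := (HasFDerivAt.comp (g := actCoord m G (oneChart m G)) (f := fun b : Cn m => (a, b))
      (oneCoord m G) (differentiableAt_actCoord hφ ha oneCoord_mem ha1).hasFDerivAt
      (hasFDerivAt_prodMk_right a (oneCoord m G))).fderiv
    rw [mpullback_apply, h1]
    refine (mfderiv_chart_apply hφ ho (mul_one _) ((oneChart m G).map_target ha) X).trans ?_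
    exact DFunLike.congr_fun h2 (lieCoord X)
  have hpb := mpullback_mlieBracket (I := 𝓘(ℂ, Cn m)) (I' := 𝓘(ℂ, Cn m)) (n := ω)
    (f := (oneChart m G).symm) (x₀ := oneCoord m G)
    (mdifferentiableAt_mulInvariantVectorField X) (mdifferentiableAt_mulInvariantVectorField Y)
    (contMDiffAt_symm_of_mem_maximalAtlas hφ oneCoord_mem) (by simp)
  have hT : ∀ᶠ a in 𝓝 (oneCoord m G), a ∈ (oneChart m G).target :=
    (oneChart m G).open_target.mem_nhds oneCoord_mem
  have hev : ∀ X : GroupLieAlgebra 𝓘(ℂ, Cn m) G,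
      mpullback 𝓘(ℂ, Cn m) 𝓘(ℂ, Cn m) (oneChart m G).symm (mulInvariantVectorField X)
        =ᶠ[𝓝 (oneCoord m G)]
          fun a => fderiv ℂ (actCoord m G (oneChart m G)) (a, oneCoord m G) (0, lieCoord X) :=
    fun X => by filter_upwards [hT] with a ha using hmul X a ha
  rw [Filter.EventuallyEq.mlieBracket_vectorField_eq (hev X) (hev Y)] at hpb
  -- The base point is a variable because the tangent spaces depend on it.
  have hone : ∀ g : G, (oneChart m G).symm (oneCoord m G) = g →
      mfderiv 𝓘(ℂ, Cn m) 𝓘(ℂ, Cn m) (oneChart m G) g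
        (mlieBracket 𝓘(ℂ, Cn m) (mulInvariantVectorField X) (mulInvariantVectorField Y) g)
      = lieBracket ℂ
        (fun a => fderiv ℂ (actCoord m G (oneChart m G)) (a, oneCoord m G) (0, lieCoord X))
        (fun a => fderiv ℂ (actCoord m G (oneChart m G)) (a, oneCoord m G) (0, lieCoord Y))
        (oneCoord m G) := by
    rintro _ rfl
    rw [mpullback_apply, ContinuousLinearMap.inverse_eq
      (mfderiv_symm_chart_comp hφ oneCoord_mem)
      ((mdifferentiable_of_mem_maximalAtlas hφ).comp_symm_deriv oneCoord_mem)] at hpb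
    exact hpb.trans (mlieBracket_eq_lieBracket _ _ _)
  exact hone 1 oneChart_symm_oneCoord

/-- The vector fields generated by `X` and `Y` have bracket minus the field generated by
`⁅X, Y⁆`. -/
theorem lieBracket_fundField (X Y : GroupLieAlgebra 𝓘(ℂ, Cn m) G) {z : Cn n} (hz : z ∈ e.target) :
    lieBracket ℂ (fundField e X) (fundField e Y) z = -fundField e ⁅X, Y⁆ z := by
  have hp : oneCoord m G ∈ (oneChart m G).target := oneCoord_mem
  have hφ := oneChart_mem m G
  have hzs := smul_chart_symm_mem (G := G) (m := m) hz
  have hμ : ContDiffAt ℂ ω (actCoord m G (oneChart m G)) (oneCoord m G, oneCoord m G) :=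
    contDiffAt_actCoord hφ hp hp (smul_chart_symm_mem hp)
  have hT : ∀ᶠ a in 𝓝 (oneCoord m G), a ∈ (oneChart m G).target :=
    (oneChart m G).open_target.mem_nhds hp
  have hf : ContDiffAt ℂ ω (fun b => actCoord m G e (b, z)) (oneCoord m G) :=
    ContDiffAt.comp (g := actCoord m G e) (f := fun b : Cn m => (b, z)) (oneCoord m G)
      (contDiffAt_actCoord he hp hz hzs) (contDiffAt_id.prodMk contDiffAt_const)
  have hR : ∀ X : GroupLieAlgebra 𝓘(ℂ, Cn m) G, DifferentiableAt ℂ (fun b =>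
      fderiv ℂ (actCoord m G (oneChart m G)) (oneCoord m G, b) (lieCoord X, 0)) (oneCoord m G) :=
    fun X => (DifferentiableAt.comp (g := fderiv ℂ (actCoord m G (oneChart m G)))
      (f := fun b : Cn m => (oneCoord m G, b)) (oneCoord m G)
      ((hμ.fderiv_right (m := ω) (by simp)).differentiableAt (by simp))
      (hasFDerivAt_prodMk_right _ _).differentiableAt).clm_apply (differentiableAt_const _)
  have hfp : actCoord m G e (oneCoord m G, z) = z := actCoord_oneCoord hz
  have hs : ∀ X : GroupLieAlgebra 𝓘(ℂ, Cn m) G,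
      DifferentiableAt ℂ (fundField e X) (actCoord m G e (oneCoord m G, z)) := fun X => by
    rw [hfp]
    exact (contDiffAt_fundField he X hz).differentiableAt (by simp)
  -- The orbit map relates right invariant fields to generated fields, whereas the bracket of
  -- `GroupLieAlgebra` comes from left invariant ones; hence the sign.
  have key := fderiv_lieBracket_of_related hf (hR X) (hR Y) (hs X) (hs Y)
    (eventually_fderiv_orbit he X hz) (eventually_fderiv_orbit he Y hz)
  rw [hfp, lieBracket_right_invariant hμ
    (by filter_upwards [hT] with a ha using actCoord_mul_oneCoord ha)
    (by filter_upwards [hT] with a ha using actCoord_oneCoord ha), ← lieCoord_lie, map_neg,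
    (hasFDerivAt_actCoord_left he hp hz hzs).fderiv] at key
  rw [← key, fundField_eq he _ hz]
  rfl

end Fundamental

/-! ### The induced metric on the homogeneous manifold -/

section Induced

open VectorField

variable {m n : ℕ} {G : Type*} [TopologicalSpace G] [ChartedSpace (Cn m) G] [Group G]
  {M : Type*} [TopologicalSpace M] [ChartedSpace (Cn n) M] [MulAction G M]
  {ι : Type*} [Fintype ι] (b : Module.Basis ι ℂ (GroupLieAlgebra 𝓘(ℂ, Cn m) G))
  {e : OpenPartialHomeomorph M (Cn n)}

variable (e) in
/-- The components in a chart of the vector fields generated by a basis of the Lie algebra. -/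
def frame (a : ι) (k : Fin n) (z : Cn n) : ℂ := fundField e (b a) z k

-- `horizontalLift` is a choice with default value `0`; uniqueness of lifts identifies it.
variable {b} in
theorem horizontalLift_eq {x : M} {v : TangentSpace 𝓘(ℂ, Cn n) x}
    {X : GroupLieAlgebra 𝓘(ℂ, Cn m) G}
    (h : IsLift b (ev (m := m) (n := n) G x).toLinearMap v X) :
    horizontalLift (basisForm b) x v = X := by
  have H : ∃ X : GroupLieAlgebra 𝓘(ℂ, Cn m) G,
      (∀ Y : GroupLieAlgebra 𝓘(ℂ, Cn m) G, ev (n := n) G x Y = 0 → basisForm b X Y = 0) ∧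
        ev G x X = v := ⟨X, h⟩
  rw [horizontalLift, dif_pos H]
  exact IsLift.unique (b := b) (T := (ev (m := m) (n := n) G x).toLinearMap)
    H.choose_spec h

variable (hM : IsHomogeneousManifold m n G M)
  (he : e ∈ IsManifold.maximalAtlas 𝓘(ℂ, Cn n) ω M) {z : Cn n} (hz : z ∈ e.target)

include hM he hz

/-- Orbit maps are submersions, so the generated fields span each tangent space. -/
theorem isUnit_det_gram_frame : IsUnit (gram (frame b e) z).det := by
  refine isUnit_det_vecGram fun u => ?_
  obtain ⟨X, hX⟩ := hM.submersion (e.symm z)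
    (mfderiv 𝓘(ℂ, Cn n) 𝓘(ℂ, Cn n) e.symm z (WithLp.toLp 2 u))
  refine ⟨fun a => b.repr X a, fun k => ?_⟩
  have h1 := mfderiv_chart_symm_apply he hz (WithLp.toLp 2 u)
  rw [← hX] at h1
  have h2 : fundField e X z = WithLp.toLp 2 u := h1
  have h3 : fundField e X z = ∑ a, b.repr X a • fundField e (b a) z := by
    conv_lhs => rw [← b.sum_repr X]
    simp only [fundField, map_sum, map_smul]
    rfl
  calc ∑ a, b.repr X a * frame b e a k z = (∑ a, b.repr X a • fundField e (b a) z) k := by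
        simp [frame]
    _ = u k := by rw [← h3, h2]

theorem isLift_frame (v : TangentSpace 𝓘(ℂ, Cn n) (e.symm z)) {u : Fin n → ℂ}
    (hu : mfderiv 𝓘(ℂ, Cn n) 𝓘(ℂ, Cn n) e (e.symm z) v = WithLp.toLp 2 u) :
    IsLift b (ev (m := m) (n := n) G (e.symm z)).toLinearMap v
      (coordLift b (fun a k => frame b e a k z) u) := by
  refine isLift_coordLift (isUnit_det_gram_frame b hM he hz)
    ((EuclideanSpace.equiv (Fin n) ℂ).toLinearMap ∘ₗ
      (mfderiv 𝓘(ℂ, Cn n) 𝓘(ℂ, Cn n) e (e.symm z)).toLinearMap) ?_ (fun a k => rfl) ?_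
  · exact (EuclideanSpace.equiv (Fin n) ℂ).injective.comp
      (mfderiv_chart_injective he (e.map_target hz))
  · change EuclideanSpace.equiv (Fin n) ℂ (mfderiv 𝓘(ℂ, Cn n) 𝓘(ℂ, Cn n) e (e.symm z) v) = u
    rw [hu]
    rfl

theorem coordMetric_inducedMetric :
    coordMetric (inducedMetric (n := n) (M := M) (basisForm b)) e z
      = ((gram (frame b e) z)⁻¹).transpose := by
  ext i j
  have h : ∀ i, horizontalLift (basisForm b) (e.symm z)
      (mfderiv 𝓘(ℂ, Cn n) 𝓘(ℂ, Cn n) e.symm z (stdVec i))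
      = coordLift b (fun a k => frame b e a k z) (Pi.single i 1) := fun i =>
    horizontalLift_eq (isLift_frame b hM he hz _ (mfderiv_chart_symm_apply he hz _))
  change basisForm b _ _ = _
  rw [h, h]
  exact basisForm_coordLift (isUnit_det_gram_frame b hM he hz) i j

omit hz in
theorem isFrameOn_frame [LieGroup 𝓘(ℂ, Cn m) ω G] : IsFrameOn (frame b e)
    (coordMetric (inducedMetric (n := n) (M := M) (basisForm b)) e) e.target where
  isOpen := e.open_target
  holomorphic z hz a i := by
    have := hM.holomorphic
    exact contDiffAt_euclidean.1 (contDiffAt_fundField he (b a) hz) i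
  isUnit_det z hz := isUnit_det_gram_frame b hM he hz
  metric_eq z hz := coordMetric_inducedMetric b hM he hz

/-- Generating vector fields is an antihomomorphism, whence `-C`. The sign is harmless, as the
condition on the structure constants is quadratic. -/
theorem bracket_frame [LieGroup 𝓘(ℂ, Cn m) ω G] {C : ι → ι → ι → ℝ}
    (hC : ∀ a c, ⁅b a, b c⁆ = ∑ d, (C a c d : ℂ) • b d) (a c : ι) (k : Fin n) :
    ∑ i, (frame b e a i z * dz i (frame b e c k) z - frame b e c i z * dz i (frame b e a k) z)
      = ∑ d, (-C a c d : ℝ) * frame b e d k z := by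
  have := hM.holomorphic
  have hd : ∀ a, DifferentiableAt ℂ (fundField e (b a)) z := fun a =>
    (contDiffAt_fundField he (b a) hz).differentiableAt (by simp)
  have hk : ∀ a v, fderiv ℂ (frame b e a k) z v = fderiv ℂ (fundField e (b a)) z v k := by
    intro a v
    have h1 := ((EuclideanSpace.proj (𝕜 := ℂ) k).hasFDerivAt.comp z (hd a).hasFDerivAt).fderiv
    exact DFunLike.congr_fun h1 v
  have hkd : ∀ a, DifferentiableAt ℂ (frame b e a k) z := fun a =>
    differentiableAt_euclidean.1 (hd a) k
  have hv : ∀ v : Cn n, ∑ i, v i • stdVec i = v := fun v => by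
    ext j
    simp [stdVec, Pi.single_apply]
  have hsum : ∀ a c, ∑ i, frame b e a i z * dz i (frame b e c k) z
      = fderiv ℂ (fundField e (b c)) z (fundField e (b a) z) k := fun a c => by
    rw [← hk, ← hv (fundField e (b a) z), map_sum]
    refine Finset.sum_congr rfl fun i _ => ?_
    rw [map_smul, dz_eq_fderiv i (hkd c), smul_eq_mul]
    rfl
  have hlie : fundField e ⁅b a, b c⁆ z = ∑ d, (C a c d : ℂ) • fundField e (b d) z := by
    rw [hC]
    simp only [fundField, map_sum, map_smul]
    rfl
  rw [Finset.sum_sub_distrib, hsum, hsum]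
  have key := congrArg (fun v : Cn n => v k) (lieBracket_fundField he (b a) (b c) hz)
  simp only [lieBracket, hlie] at key
  rw [PiLp.sub_apply] at key
  rw [key]
  simp [frame]

omit he hz in
theorem exists_isLift [IsManifold 𝓘(ℂ, Cn n) ω M] (x : M) (v : TangentSpace 𝓘(ℂ, Cn n) x) :
    ∃ X, IsLift b (ev (m := m) (n := n) G x).toLinearMap v X := by
  have h : ∀ y, (chartAt (Cn n) x).symm (chartAt (Cn n) x x) = y →
      ∀ v : TangentSpace 𝓘(ℂ, Cn n) y,
        ∃ X, IsLift b (ev (m := m) (n := n) G y).toLinearMap v X := by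
    rintro _ rfl v
    exact ⟨_, isLift_frame b hM (IsManifold.chart_mem_maximalAtlas x) (mem_chart_target _ _) v rfl⟩
  exact h x ((chartAt (Cn n) x).left_inv (mem_chart_source _ _)) v

omit he hz in
/-- The induced metric is Hermitian. -/
theorem isHermitianMetric_inducedMetric [LieGroup 𝓘(ℂ, Cn m) ω G]
    [IsManifold 𝓘(ℂ, Cn n) ω M] :
    IsHermitianMetric (inducedMetric (n := n) (M := M) (basisForm b)) where
  add_left x v v' w := by
    obtain ⟨X, hX⟩ := exists_isLift b hM x v
    obtain ⟨X', hX'⟩ := exists_isLift b hM x v'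
    rw [inducedMetric, inducedMetric, inducedMetric, horizontalLift_eq hX, horizontalLift_eq hX',
      horizontalLift_eq (hX.add hX'), basisForm_add_left]
  smul_left x c v w := by
    obtain ⟨X, hX⟩ := exists_isLift b hM x v
    rw [inducedMetric, inducedMetric, horizontalLift_eq hX, horizontalLift_eq (hX.smul c),
      basisForm_smul_left]
  conj_symm x v w := basisForm_conj_symm b _ _
  pos x v hv := by
    obtain ⟨X, hX⟩ := exists_isLift b hM x v
    rw [inducedMetric, horizontalLift_eq hX]
    refine basisForm_self_pos b fun h0 => hv ?_
    rw [← hX.2, h0, map_zero]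
  smooth e he i j z hz :=
    (((isFrameOn_frame b hM he).contDiffAt_metric hz i j).of_le (by simp)).contDiffWithinAt

omit he hz in
/-- The induced metric is scale-static if the structure constants of the basis are, up to a factor,
orthonormal. -/
theorem thetaEqSmul_inducedMetric [LieGroup 𝓘(ℂ, Cn m) ω G] [DecidableEq ι]
    {C : ι → ι → ι → ℝ} {c : ℝ} (hC : ∀ a c, ⁅b a, b c⁆ = ∑ d, (C a c d : ℂ) • b d)
    (hCc : ∀ p q, ∑ a, ∑ b, C a b p * C a b q = 2 * c * if p = q then 1 else 0) :
    ThetaEqSmul (inducedMetric (n := n) (M := M) (basisForm b)) c := fun e he z hz i j =>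
  (isFrameOn_frame b hM he).theta_eq hz (fun a b d => -C a b d) c (by simpa using hCc)
    (bracket_frame b hM he hz hC) i j

end Induced

end HCF

end

theorem mainTheorem4 {m n : ℕ}
    {G : Type*} [TopologicalSpace G] [ChartedSpace (HCF.Cn m) G] [Group G]
    [LieGroup 𝓘(ℂ, HCF.Cn m) ω G]
    {𝔨 : Type*} [LieRing 𝔨] [LieAlgebra ℝ 𝔨] [FiniteDimensional ℝ 𝔨] [LieAlgebra.IsSimple ℝ 𝔨]
    (B : LinearMap.BilinForm ℝ 𝔨) (hB : HCF.IsInvariantMetric B)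
    (Φ : (ℂ ⊗[ℝ] 𝔨) ≃ₗ⁅ℂ⁆ GroupLieAlgebra 𝓘(ℂ, HCF.Cn m) G)
    {M : Type*} [TopologicalSpace M] [ChartedSpace (HCF.Cn n) M]
    [IsManifold 𝓘(ℂ, HCF.Cn n) ω M] [MulAction G M] (hM : HCF.IsHomogeneousManifold m n G M) :
    HCF.IsInvariantMetric (-killingForm ℝ 𝔨) ∧
      HCF.IsHermitianMetric (HCF.inducedMetric (n := n) (M := M) (HCF.kappaInv B Φ)) ∧
      ∃ c : ℝ, 0 < c ∧
        HCF.ThetaEqSmul (HCF.inducedMetric (n := n) (M := M) (HCF.kappaInv B Φ)) c := by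
  obtain ⟨e, he⟩ := hB.exists_basis
  obtain ⟨c, hc, hCc⟩ := hB.exists_structureConstants e he
  rw [HCF.kappaInv_eq_basisForm e he Φ]
  exact ⟨hB.neg_killingForm, HCF.isHermitianMetric_inducedMetric _ hM, c, hc,
    HCF.thetaEqSmul_inducedMetric _ hM (HCF.lie_complexBasis e Φ) hCc⟩
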